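/- \textbf{Model.} Let $k,\alpha,\beta>0$, $T_m\in\mathbb R$, $L>0$, and a setpoint $s_r<L$. Consider the one-phase Stefan problem with actuator dynamics $$T_t=\alpha T_{xx}\ (0<x<s(t)),\quad -kT_x(0,t)=q_c(t),\quad T(s(t),t)=T_m,\quad \dot s(t)=-\beta T_x(s(t),t),\quad \dot q_c(t)=U(t)$$ for $t>0$, with $s(0)=s_0$, $T(x,0)=T_0(x)$ for $x\in(0,s_0]$ (classical solutions: $s>0$; $s$ and $q_c$ are continuous for $t\ge0$; $T$ is continuous on $\{t\ge 0,\ 0\le x\le s(t)\}$; $T_x$ is continuous on $\{t>0,\ 0\le x\le s(t)\}$; $T_t,T_{xx}$ are continuous on $\{t>0,\ 0<x<s(t)\}$; at jumps of $U$ the actuator equation is meant with the right derivative). Put $$\sigma(t)=-\Big(\tfrac k\alpha\int_0^{s(t)}(T(x,t)-T_m)\,dx+\tfrac k\beta(s(t)-s_r)\Big),\quad h_2=q_c,\quad h_3=-q_c+c_1\sigma,\quad U^*=-c_1h_2+c_2h_3,$$ with gains $c_1,c_2>0$. \textbf{Event-triggered control.} Let $\delta_1>0$, $\delta_2\in(0,1)$,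 $\mu_1=\min\{\delta_1c_1,(1-\delta_2)c_2\}$. The input is $U(t)=U^*(t_j)$ for $t\in[t_j,t_{j+1})$, where $t_0=0$ and, with $\tilde U^*(t)=U^*(t)-U^*(t_j)$, $$t_{j+1}=\inf\big\{t>t_j:\ -\delta_2c_2h_3(t)>\tilde U^*(t)\ \text{ or }\ \tilde U^*(t)>\mu_1h_2(t)+\delta_2c_2h_3(t)\big\}\qquad(\inf\emptyset=\infty),$$ the signals in this set being evaluated along the motion of the plant from its state at time $t_j$ with the input held at $U^*(t_j)$. \textbf{Theorem.} For all parameters as above there exist constants $M>0$ and $b>0$, depending only on $k,\alpha,\beta,T_m,L,s_r,c_1,c_2,\delta_1,\delta_2$ and not on the initial condition, such that the following holds. Suppose that - $0<s_0<L$, $T_0\in C^1([0,s_0];[T_m,\infty))$, $T_0(s_0)=T_m$; - $q_c(0)\ge0$; - $s_0+\frac\beta\alpha\int_0^{s_0}(T_0(x)-T_m)\,dx\le s_r$; - $q_c(0)\le c_1\,\sigma(0)$ (for $\sigma(0)>0$ this is $c_1\ge q_c(0)/\sigma(0)$). Then every solution of the closed-loop system on a time interval $[0,t_{\rm end})$,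 $0<t_{\rm end}\le\infty$, satisfies $$\Phi(t)\le M\,\Phi(0)\,e^{-bt}\quad\text{for all }t\in[0,t_{\rm end}),\qquad \Phi(t):=\int_0^{s(t)}(T(x,t)-T_m)^2dx+(s(t)-s_r)^2+q_c(t)^2.$$ In particular, with $t_{\rm end}=\infty$, the closed-loop system is globally (for all initial conditions in the safe set) exponentially stable at the equilibrium $s=s_r$, $T\equiv T_m$, $q_c=0$. -/

import Mathlib

open Set

noncomputable section

/-- Physical constants of the one-phase Stefan model: thermal conductivity `k`, diffusivity `α`,
interface coefficient `β`, melting temperature `Tm`. -/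
structure StefanParams where
  k : ℝ
  α : ℝ
  β : ℝ
  Tm : ℝ

/-- Parameters of the event-triggered controller: feedback gains `c₁, c₂` and triggering
parameters `δ₁, δ₂`. -/
structure ETCGains where
  c₁ : ℝ
  c₂ : ℝ
  δ₁ : ℝ
  δ₂ : ℝ

/-- Spatial derivative `T_x(x,t)` on the liquid phase `[0, s(t)]`, one-sided at the end points. -/
def spaceDeriv (T : ℝ → ℝ → ℝ) (s : ℝ → ℝ) (x t : ℝ) : ℝ :=
  derivWithin (fun y => T y t) (Icc 0 (s t)) x

/-- `(T, s, q)` is a classical solution, on the time interval `[a, b)`, of the one-phase Stefan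
problem driven through the actuator `q̇ = U`. Here `b` may be `⊤`; `T x t` is only meaningful
for `0 ≤ x ≤ s t`. The regularity is the classical one: `T` is continuous up to the parabolic
boundary, `T_x` is continuous up to the lateral boundary for positive elapsed time, and
`T_t`, `T_xx` exist and are continuous in the interior. The actuator equation uses the right
derivative of the continuous function `q`, since `U` may jump. -/
structure IsStefanSolution (P : StefanParams) (T : ℝ → ℝ → ℝ) (s q U : ℝ → ℝ)
    (a : ℝ) (b : EReal) : Prop where
  s_pos : ∀ t : ℝ, a ≤ t → (t : EReal) < b → 0 < s t
  s_cont : ContinuousOn s {t : ℝ | a ≤ t ∧ (t : EReal) < b}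
  T_cont : ContinuousOn (fun p : ℝ × ℝ => T p.1 p.2)
    {p : ℝ × ℝ | a ≤ p.2 ∧ (p.2 : EReal) < b ∧ 0 ≤ p.1 ∧ p.1 ≤ s p.2}
  T_diff_x : ∀ t : ℝ, a < t → (t : EReal) < b →
    DifferentiableOn ℝ (fun x => T x t) (Icc 0 (s t))
  Tx_cont : ContinuousOn (fun p : ℝ × ℝ => spaceDeriv T s p.1 p.2)
    {p : ℝ × ℝ | a < p.2 ∧ (p.2 : EReal) < b ∧ 0 ≤ p.1 ∧ p.1 ≤ s p.2}
  T_diff_xx : ∀ t x : ℝ, a < t → (t : EReal) < b → 0 < x → x < s t →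
    DifferentiableAt ℝ (fun y => spaceDeriv T s y t) x
  T_diff_t : ∀ t x : ℝ, a < t → (t : EReal) < b → 0 < x → x < s t →
    DifferentiableAt ℝ (fun r => T x r) t
  Tt_cont : ContinuousOn (fun p : ℝ × ℝ => deriv (fun r => T p.1 r) p.2)
    {p : ℝ × ℝ | a < p.2 ∧ (p.2 : EReal) < b ∧ 0 < p.1 ∧ p.1 < s p.2}
  Txx_cont : ContinuousOn (fun p : ℝ × ℝ => deriv (fun y => spaceDeriv T s y p.2) p.1)
    {p : ℝ × ℝ | a < p.2 ∧ (p.2 : EReal) < b ∧ 0 < p.1 ∧ p.1 < s p.2}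
  /-- heat equation -/
  heat : ∀ t x : ℝ, a < t → (t : EReal) < b → 0 < x → x < s t →
    deriv (fun r => T x r) t = P.α * deriv (fun y => spaceDeriv T s y t) x
  /-- heat flux at the fixed boundary -/
  flux : ∀ t : ℝ, a < t → (t : EReal) < b → -P.k * spaceDeriv T s 0 t = q t
  /-- melting temperature at the interface -/
  melt : ∀ t : ℝ, a < t → (t : EReal) < b → T (s t) t = P.Tm
  /-- interface dynamics -/
  interface : ∀ t : ℝ, a < t → (t : EReal) < b →
    HasDerivAt s (-P.β * spaceDeriv T s (s t) t) t
  q_cont : ContinuousOn q {t : ℝ | a ≤ t ∧ (t : EReal) < b}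
  /-- actuator dynamics -/
  actuator : ∀ t : ℝ, a ≤ t → (t : EReal) < b → HasDerivWithinAt q (U t) (Ici t) t

/-- The energy deficit
`σ(t) = -((k/α) ∫₀^{s(t)} (T(x,t) - Tm) dx + (k/β) (s(t) - sr))`, i.e. `h₁`. -/
def energyDeficit (P : StefanParams) (sr : ℝ) (T : ℝ → ℝ → ℝ) (s : ℝ → ℝ) (t : ℝ) : ℝ :=
  -(P.k / P.α * (∫ x in (0 : ℝ)..(s t), (T x t - P.Tm)) + P.k / P.β * (s t - sr))

/-- `h₃(t) = -q(t) + c₁ σ(t)`; recall that `h₂ = q`. -/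
def barrierThree (P : StefanParams) (G : ETCGains) (sr : ℝ) (T : ℝ → ℝ → ℝ) (s q : ℝ → ℝ)
    (t : ℝ) : ℝ :=
  -q t + G.c₁ * energyDeficit P sr T s t

/-- The continuous-time control law `U*(t) = -c₁ h₂(t) + c₂ h₃(t)`. -/
def nominalControl (P : StefanParams) (G : ETCGains) (sr : ℝ) (T : ℝ → ℝ → ℝ) (s q : ℝ → ℝ)
    (t : ℝ) : ℝ :=
  -G.c₁ * q t + G.c₂ * barrierThree P G sr T s q t

/-- `μ₁ = min {δ₁ c₁, (1 - δ₂) c₂}`. -/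
def ETCGains.μ₁ (G : ETCGains) : ℝ := min (G.δ₁ * G.c₁) ((1 - G.δ₂) * G.c₂)

/-- The triggering inequality at time `t`, along the signals `(T, s, q)`, with last event at `a`:
`-δ₂ c₂ h₃(t) > Ũ*(t)` or `Ũ*(t) > μ₁ h₂(t) + δ₂ c₂ h₃(t)`, where `Ũ*(t) = U*(t) - U*(a)`. -/
def Triggered (P : StefanParams) (G : ETCGains) (sr : ℝ) (T : ℝ → ℝ → ℝ) (s q : ℝ → ℝ)
    (a t : ℝ) : Prop :=
  -G.δ₂ * G.c₂ * barrierThree P G sr T s q t >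
      nominalControl P G sr T s q t - nominalControl P G sr T s q a ∨
    nominalControl P G sr T s q t - nominalControl P G sr T s q a >
      G.μ₁ * q t + G.δ₂ * G.c₂ * barrierThree P G sr T s q t

/-- The set of times `t > a` at which the triggering inequality holds along the motion of the
plant which starts at time `a` in the state `(T(·,a), s(a), q(a))` and has its input held at the
value `U*(a)`. Up to the next event this motion is the closed-loop trajectory itself; beyond that
event it is the continuation that would occur without an update of the input. -/
def triggerSet (P : StefanParams) (G : ETCGains) (sr : ℝ) (T : ℝ → ℝ → ℝ) (s q : ℝ → ℝ)
    (a : ℝ) : Set ℝ :=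
  {t : ℝ | a < t ∧ ∃ (T' : ℝ → ℝ → ℝ) (s' q' : ℝ → ℝ) (b : ℝ), t < b ∧
    IsStefanSolution P T' s' q' (fun _ => nominalControl P G sr T s q a) a b ∧
    s' a = s a ∧ q' a = q a ∧ (∀ x ∈ Icc 0 (s a), T' x a = T x a) ∧
    Triggered P G sr T' s' q' a t}

/-- `(T, s, q)` is a solution on `[0, tEnd)` of the closed loop: the plant driven by `U`, where
`U` is the zero-order hold of `U*` over the event times `e 0 < e 1 < …` generated by the
triggering rule. An event time equal to `⊤` means that there is no further event
(the infimum of the empty set is `⊤` in `EReal`). -/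
structure IsClosedLoopSolution (P : StefanParams) (G : ETCGains) (sr : ℝ) (T : ℝ → ℝ → ℝ)
    (s q U : ℝ → ℝ) (e : ℕ → EReal) (tEnd : EReal) : Prop where
  plant : IsStefanSolution P T s q U 0 tEnd
  event_zero : e 0 = 0
  event_succ : ∀ (j : ℕ) (a : ℝ), e j = (a : EReal) →
    e (j + 1) = sInf ((fun t : ℝ => (t : EReal)) '' triggerSet P G sr T s q a)
  event_top : ∀ j : ℕ, e j = ⊤ → e (j + 1) = ⊤
  hold : ∀ (j : ℕ) (a : ℝ), e j = (a : EReal) → ∀ t : ℝ, a ≤ t → (t : EReal) < e (j + 1) →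
    (t : EReal) < tEnd → U t = nominalControl P G sr T s q a

/-- `Φ(t) = ‖T[t] - Tm‖² + (s(t) - sr)² + q(t)²`, with the `L²(0, s(t))` norm. -/
def stabilityNorm (P : StefanParams) (sr : ℝ) (T : ℝ → ℝ → ℝ) (s q : ℝ → ℝ) (t : ℝ) : ℝ :=
  (∫ x in (0 : ℝ)..(s t), (T x t - P.Tm) ^ 2) + (s t - sr) ^ 2 + q t ^ 2

end

noncomputable section

open Filter Topology MeasureTheory

/-! Energy conservation reduces the control problem to an ODE: the interface fluxes cancel in `σ`,
so `σ' = -q` (`hasDerivAt_energyDeficit`), while `q' = U` and `h₃' = -U - c₁ q`. As long as no event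
occurs, the two triggering bounds on `U* - U` read `h₃' ≥ -(1 + δ₂) c₂ h₃` and `q' ≥ -(c₁ + μ₁) q +
(1 - δ₂) c₂ h₃`, so `h₃` and then `q` stay nonnegative (`barrier_bounds`). Events cannot accumulate:
under a held input `q` and `σ` are explicit polynomials in time, and the triggering inequalities,
being linear in the nonnegative values of `q` and `h₃` at the event, hold for a time independent of
the state (`exists_dwell_time`).

Nonnegative flux gives `T ≥ Tm` by an energy form of the maximum principle (`melting_le`). Since `c₁
σ = q + h₃ ≥ 0`, the interface never passes `sr` (`safety`), which makes the Poincaré constant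
uniform.

The function `V = (μ₁ + c₁) σ + h₃` is weighted so that the lower bound on `U` leaves `V' ≤ -c₁ q -
(1 - δ₂) c₂ h₃ ≤ -b₀ V`. The thermal energy `Y = ‖T - Tm‖²` satisfies `Y' ≤ -(α/sr²) Y + C q²`, and
`q ≤ V`, so `Y + K V²` decays exponentially for `K = C/b₀`. It dominates `Φ` up to a constant at all
times, and is dominated by `Φ` at time `0`, because `T ≥ Tm` bounds `σ` by a multiple of `sr - s`.

The analytic work lies in differentiating `∫ φ(T - Tm)` over a moving domain when `T_t` and `T_xx`
are controlled only in the interior (`hasDerivAt_integral`). The cases `φ = x`, `min(x, 0)⁴` and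
`x²` give `σ`, the maximum principle and `Y`. -/

/-! ### Energy identity on a fixed interval, by interior truncation. -/

/-- Compactness of `[a, b]` times a closed time window around `t` supplies the constant dominating
function. -/
theorem hasDerivAt_intervalIntegral_of_continuousOn_deriv {F F' : ℝ → ℝ → ℝ} {a b t₁ t₂ t : ℝ}
    (hab : a ≤ b) (ht : t ∈ Ioo t₁ t₂)
    (hF : ∀ r ∈ Ioo t₁ t₂, ContinuousOn (fun y => F y r) (Icc a b))
    (hF' : ContinuousOn (fun p : ℝ × ℝ => F' p.1 p.2) (Icc a b ×ˢ Ioo t₁ t₂))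
    (hd : ∀ y ∈ Icc a b, ∀ r ∈ Ioo t₁ t₂, HasDerivAt (F y) (F' y r) r) :
    HasDerivAt (fun r => ∫ y in a..b, F y r) (∫ y in a..b, F' y t) t := by
  obtain ⟨u, hu, hut⟩ := exists_between ht.1
  obtain ⟨w, hw, hwt⟩ := exists_between ht.2
  have hsub : Icc u w ⊆ Ioo t₁ t₂ := fun r hr => ⟨hu.trans_le hr.1, hr.2.trans_lt hwt⟩
  have hIoc : uIoc a b ⊆ Icc a b := by
    rw [uIoc_of_le hab]; exact Ioc_subset_Icc_self
  obtain ⟨C, hC⟩ := (isCompact_Icc.prod isCompact_Icc).exists_bound_of_continuousOn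
    (hF'.mono (prod_mono_right hsub))
  refine (intervalIntegral.hasDerivAt_integral_of_dominated_loc_of_deriv_le
    (F := fun r y => F y r) (F' := fun r y => F' y r) (bound := fun _ => C) (s := Icc u w)
    (Icc_mem_nhds hut hw) ?_ ?_ ?_ ?_ ?_ ?_).2
  · filter_upwards [Ioo_mem_nhds ht.1 ht.2] with r hr
    exact ((hF r hr).mono hIoc).aestronglyMeasurable measurableSet_uIoc
  · exact ContinuousOn.intervalIntegrable (by rw [uIcc_of_le hab]; exact hF t ht)
  · refine ContinuousOn.aestronglyMeasurable (ContinuousOn.mono ?_ hIoc) measurableSet_uIoc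
    exact hF'.comp (f := fun y => (y, t)) (by fun_prop) fun y hy => ⟨hy, ht⟩
  · exact ae_of_all _ fun y hy r hr => hC (y, r) ⟨hIoc hy, hr⟩
  · exact intervalIntegrable_const
  · exact ae_of_all _ fun y hy r hr => hd y (hIoc hy) r (hsub hr)

/-- Joint continuity of an integral in its limits and a parameter. -/
theorem continuous_intervalIntegral_symm {f : ℝ → ℝ → ℝ}
    (hf : Continuous fun p : ℝ × ℝ => f p.1 p.2) :
    Continuous fun p : ℝ × ℝ => ∫ y in p.1..(1 - p.1), f y p.2 := by
  have h : ∀ g : ℝ × ℝ → ℝ, Continuous g →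
      Continuous fun p : ℝ × ℝ => ∫ y in (0 : ℝ)..g p, f y p.2 := by
    intro g hg
    exact intervalIntegral.continuous_parametric_intervalIntegral_of_continuous
      (f := fun (p : ℝ × ℝ) y => f y p.2) (by
        exact hf.comp (f := fun q : (ℝ × ℝ) × ℝ => (q.2, q.1.2)) (by fun_prop)) hg
  have hi : ∀ t c d : ℝ, IntervalIntegrable (fun y => f y t) volume c d := fun t c d =>
    (hf.comp (f := fun y : ℝ => (y, t)) (by fun_prop)).intervalIntegrable c d
  refine ((h (fun p => 1 - p.1) (by fun_prop)).sub (h (fun p => p.1) (by fun_prop))).congr ?_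
  intro p
  exact intervalIntegral.integral_interval_sub_left (hi _ _ _) (hi _ _ _)

/-- Energy identity on the unit interval for a transported heat equation whose solution is `C¹` up
to the boundary but `C²` only in the interior. -/
theorem hasDerivAt_integral_comp_of_transported_heat {v w z : ℝ → ℝ → ℝ} {l m φ φ₁ φ₂ : ℝ → ℝ}
    {α t₁ t₂ : ℝ}
    (hv : Continuous fun p : ℝ × ℝ => v p.1 p.2) (hw : Continuous fun p : ℝ × ℝ => w p.1 p.2)
    (hz : ContinuousOn (fun p : ℝ × ℝ => z p.1 p.2) (Ioo 0 1 ×ˢ Ioo t₁ t₂))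
    (hl : Continuous l) (hl0 : ∀ t, l t ≠ 0) (hm : Continuous m)
    (hvy : ∀ y ∈ Ioo (0 : ℝ) 1, ∀ t ∈ Ioo t₁ t₂, HasDerivAt (fun x => v x t) (l t * w y t) y)
    (hwy : ∀ y ∈ Ioo (0 : ℝ) 1, ∀ t ∈ Ioo t₁ t₂, HasDerivAt (fun x => w x t) (l t * z y t) y)
    (hvt : ∀ y ∈ Ioo (0 : ℝ) 1, ∀ t ∈ Ioo t₁ t₂,
      HasDerivAt (v y) (α * z y t + y * m t * w y t) t)
    (hφ : ∀ x, HasDerivAt φ (φ₁ x) x) (hφ₁ : ∀ x, HasDerivAt φ₁ (φ₂ x) x) (hφ₂ : Continuous φ₂)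
    {t : ℝ} (ht : t ∈ Ioo t₁ t₂) :
    HasDerivAt (fun r => ∫ y in (0 : ℝ)..1, φ (v y r))
      (α / l t * (φ₁ (v 1 t) * w 1 t - φ₁ (v 0 t) * w 0 t)
        - α * (∫ y in (0 : ℝ)..1, φ₂ (v y t) * w y t ^ 2)
        + m t * ∫ y in (0 : ℝ)..1, φ₁ (v y t) * (y * w y t)) t := by
  have hφc : Continuous φ := continuous_iff_continuousAt.2 fun x => (hφ x).continuousAt
  have hφ₁c : Continuous φ₁ := continuous_iff_continuousAt.2 fun x => (hφ₁ x).continuousAt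
  -- The second derivative `z` may blow up at the end points, so the identity is first proved on
  -- `[ε, 1 - ε]`. Its right-hand side `R` contains only `v` and `w` and hence is continuous up to
  -- `ε = 0`.
  let R : ℝ → ℝ → ℝ := fun ε t =>
    α / l t * (φ₁ (v (1 - ε) t) * w (1 - ε) t - φ₁ (v ε t) * w ε t)
        - α * (∫ y in ε..(1 - ε), φ₂ (v y t) * w y t ^ 2)
        + m t * ∫ y in ε..(1 - ε), φ₁ (v y t) * (y * w y t)
  have hRc : Continuous fun p : ℝ × ℝ => R p.1 p.2 := by
    have h1 := continuous_intervalIntegral_symm (f := fun y t => φ₂ (v y t) * w y t ^ 2)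
      (by fun_prop)
    have h2 := continuous_intervalIntegral_symm (f := fun y t => φ₁ (v y t) * (y * w y t))
      (by fun_prop)
    have h3 : Continuous fun p : ℝ × ℝ => α / l p.2 :=
      continuous_const.div (by fun_prop) fun p => hl0 _
    have hv' : ∀ g : ℝ × ℝ → ℝ, Continuous g → Continuous fun p : ℝ × ℝ => v (g p) p.2 :=
      fun g hg => hv.comp (f := fun p : ℝ × ℝ => (g p, p.2)) (by fun_prop)
    have hw' : ∀ g : ℝ × ℝ → ℝ, Continuous g → Continuous fun p : ℝ × ℝ => w (g p) p.2 :=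
      fun g hg => hw.comp (f := fun p : ℝ × ℝ => (g p, p.2)) (by fun_prop)
    have h4 := hv' (fun p => 1 - p.1) (by fun_prop)
    have h5 := hw' (fun p => 1 - p.1) (by fun_prop)
    have h6 : Continuous fun p : ℝ × ℝ => m p.2 := by fun_prop
    exact ((h3.mul (((hφ₁c.comp h4).mul h5).sub ((hφ₁c.comp hv).mul hw))).sub
      (h1.const_mul α)).add (h6.mul h2)
  have hR0 : ∀ t, R 0 t = α / l t * (φ₁ (v 1 t) * w 1 t - φ₁ (v 0 t) * w 0 t)
        - α * (∫ y in (0 : ℝ)..1, φ₂ (v y t) * w y t ^ 2)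
        + m t * ∫ y in (0 : ℝ)..1, φ₁ (v y t) * (y * w y t) := by
    intro t; simp [R]
  rw [← hR0]
  have hvc : ∀ t, Continuous fun y => v y t := fun t =>
    hv.comp (f := fun y : ℝ => (y, t)) (by fun_prop)
  have hwc : ∀ t, Continuous fun y => w y t := fun t =>
    hw.comp (f := fun y : ℝ => (y, t)) (by fun_prop)
  have hder : ∀ ε ∈ Ioo (0 : ℝ) (1 / 2), ∀ t ∈ Ioo t₁ t₂,
      HasDerivAt (fun r => ∫ y in ε..(1 - ε), φ (v y r)) (R ε t) t := by
    intro ε hε t ht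
    have hle : ε ≤ 1 - ε := by linarith [hε.2]
    have hIcc : Icc ε (1 - ε) ⊆ Ioo 0 1 := fun y hy =>
      ⟨hε.1.trans_le hy.1, hy.2.trans_lt (by linarith [hε.1])⟩
    have hzc : ContinuousOn (fun p : ℝ × ℝ => z p.1 p.2) (Icc ε (1 - ε) ×ˢ Ioo t₁ t₂) :=
      hz.mono (prod_mono_left hIcc)
    have hzy : ContinuousOn (fun y => z y t) (Icc ε (1 - ε)) :=
      hzc.comp (f := fun y => (y, t)) (by fun_prop) fun y hy => ⟨hy, ht⟩
    have key := hasDerivAt_intervalIntegral_of_continuousOn_deriv (F := fun y r => φ (v y r))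
      (F' := fun y r => φ₁ (v y r) * (α * z y r + y * m r * w y r)) hle ht
      (fun r _ => (hφc.comp (hvc r)).continuousOn)
      (((hφ₁c.comp hv).continuousOn).mul ((hzc.const_mul α).add (by fun_prop)))
      (fun y hy r hr => (hφ (v y r)).comp r (hvt y (hIcc hy) r hr))
    convert key using 1
    have hc := hvc t
    have hcw := hwc t
    have hi1 : IntervalIntegrable (fun y => l t * (φ₂ (v y t) * w y t ^ 2)) volume ε (1 - ε) :=
      Continuous.intervalIntegrable (by fun_prop) _ _
    have hi2 : IntervalIntegrable (fun y => l t * (φ₁ (v y t) * z y t)) volume ε (1 - ε) := by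
      apply ContinuousOn.intervalIntegrable
      rw [uIcc_of_le hle]
      exact continuousOn_const.mul (ContinuousOn.mul (by fun_prop) hzy)
    have hi3 : IntervalIntegrable (fun y => m t * (φ₁ (v y t) * (y * w y t))) volume ε (1 - ε) :=
      Continuous.intervalIntegrable (by fun_prop) _ _
    -- Integration by parts, which trades the `z` term for boundary values and the dissipation.
    have hparts : (∫ y in ε..(1 - ε), (l t * (φ₂ (v y t) * w y t ^ 2)
        + l t * (φ₁ (v y t) * z y t))) =
        φ₁ (v (1 - ε) t) * w (1 - ε) t - φ₁ (v ε t) * w ε t := by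
      refine intervalIntegral.integral_eq_sub_of_hasDerivAt
        (f := fun y => φ₁ (v y t) * w y t) (fun y hy => ?_) (hi1.add hi2)
      rw [uIcc_of_le hle] at hy
      have h1 := ((hφ₁ (v y t)).comp y (hvy y (hIcc hy) t ht)).mul (hwy y (hIcc hy) t ht)
      refine h1.congr_deriv ?_
      simp only [Function.comp_apply]
      ring
    have hsplit : (∫ y in ε..(1 - ε), φ₁ (v y t) * (α * z y t + y * m t * w y t)) =
        α / l t * (∫ y in ε..(1 - ε), l t * (φ₁ (v y t) * z y t))
        + ∫ y in ε..(1 - ε), m t * (φ₁ (v y t) * (y * w y t)) := by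
      rw [← intervalIntegral.integral_const_mul, ← intervalIntegral.integral_add
        (hi2.const_mul _) hi3]
      refine intervalIntegral.integral_congr fun y _ => ?_
      have := hl0 t
      field_simp
    rw [intervalIntegral.integral_add hi1 hi2, intervalIntegral.integral_const_mul] at hparts
    simp only [R]
    rw [hsplit, ← hparts, intervalIntegral.integral_const_mul (m t)]
    have := hl0 t
    field_simp
    ring
  -- Derivatives pass to the limit `ε → 0` because joint continuity of `R` makes their convergence
  -- locally uniform in time.
  refine hasDerivAt_of_tendstoLocallyUniformlyOn (l := 𝓝[>] (0 : ℝ)) (f' := R)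
    (f := fun ε r => ∫ y in ε..(1 - ε), φ (v y r)) isOpen_Ioo ?_ ?_ ?_ ht
  · rw [tendstoLocallyUniformlyOn_iff_forall_tendsto]
    intro x _
    have h1 : Tendsto (fun p : ℝ × ℝ => R p.1 p.2) (𝓝[>] 0 ×ˢ 𝓝[Ioo t₁ t₂] x) (𝓝 (R 0 x)) :=
      (hRc.tendsto (0, x)).mono_left (by
        rw [nhds_prod_eq]; exact Filter.prod_mono nhdsWithin_le_nhds nhdsWithin_le_nhds)
    have h2 : Tendsto (fun p : ℝ × ℝ => R 0 p.2) (𝓝[>] (0 : ℝ) ×ˢ 𝓝[Ioo t₁ t₂] x) (𝓝 (R 0 x)) := by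
      have hc : Continuous fun r => R 0 r := hRc.comp (f := fun r : ℝ => ((0 : ℝ), r)) (by fun_prop)
      exact (hc.tendsto x).comp (tendsto_snd.mono_right nhdsWithin_le_nhds)
    exact tendsto_uniformity_iff_dist_tendsto_zero.2 (by simpa using h2.dist h1)
  · filter_upwards [Ioo_mem_nhdsGT (show (0 : ℝ) < 1 / 2 by norm_num)] with ε hε
    exact hder ε hε
  · intro x _
    have hc := continuous_intervalIntegral_symm (f := fun y t => φ (v y t)) (by fun_prop)
    have := (hc.comp (f := fun ε : ℝ => (ε, x)) (by fun_prop)).tendsto 0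
    simpa [Function.comp_def] using this.mono_left (nhdsWithin_le_nhds (s := Ioi 0))

/-! ### Straightening the moving domain by `x = y s(t)`. -/

/-- Chain rule along a graph `t ↦ (g t, t)` for a function with continuous partial derivatives. -/
theorem hasDerivAt_comp_graph {f f₁ f₂ : ℝ → ℝ → ℝ} {g : ℝ → ℝ} {g' t : ℝ} {Ω : Set (ℝ × ℝ)}
    (hΩ : IsOpen Ω) (hmem : (g t, t) ∈ Ω)
    (h₁ : ∀ p ∈ Ω, HasDerivAt (fun x => f x p.2) (f₁ p.1 p.2) p.1)
    (h₂ : ∀ p ∈ Ω, HasDerivAt (f p.1) (f₂ p.1 p.2) p.2)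
    (hc₁ : ContinuousOn (fun p : ℝ × ℝ => f₁ p.1 p.2) Ω)
    (hc₂ : ContinuousOn (fun p : ℝ × ℝ => f₂ p.1 p.2) Ω) (hg : HasDerivAt g g' t) :
    HasDerivAt (fun r => f (g r) r) (f₁ (g t) t * g' + f₂ (g t) t) t := by
  have hn := hΩ.mem_nhds hmem
  have hs := hasStrictFDerivAt_uncurry_coprod (𝕜 := ℝ) (u := (g t, t)) (f := f)
    (f₁ := fun x r => ContinuousLinearMap.toSpanSingleton ℝ (f₁ x r))
    (f₂ := fun x r => ContinuousLinearMap.toSpanSingleton ℝ (f₂ x r))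
    (by filter_upwards [hn] with p hp using (h₁ p hp).hasFDerivAt)
    (by filter_upwards [hn] with p hp using (h₂ p hp).hasFDerivAt)
    ((ContinuousLinearMap.toSpanSingletonCLE (𝕜 := ℝ) (E := ℝ)).continuous.continuousAt.comp
      (hc₁.continuousAt hn))
    ((ContinuousLinearMap.toSpanSingletonCLE (𝕜 := ℝ) (E := ℝ)).continuous.continuousAt.comp
      (hc₂.continuousAt hn))
  have := hs.hasFDerivAt.comp_hasDerivAt (f := fun r => (g r, r)) t (hg.prodMk (hasDerivAt_id t))
  refine this.congr_deriv ?_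
  simp [Function.HasUncurry.uncurry, mul_comm]

/-- Projection of the real line onto `[a, b]`. -/
def clamp (a b x : ℝ) : ℝ := max a (min b x)

@[fun_prop]
theorem continuous_clamp (a b : ℝ) : Continuous (clamp a b) := by
  unfold clamp; fun_prop

theorem clamp_mem {a b : ℝ} (h : a ≤ b) (x : ℝ) : clamp a b x ∈ Icc a b :=
  ⟨le_max_left _ _, max_le h (min_le_left _ _)⟩

theorem clamp_of_mem {a b x : ℝ} (h : x ∈ Icc a b) : clamp a b x = x := by
  simp [clamp, h.1, h.2]

theorem clamp_eventuallyEq {a b x : ℝ} (h : x ∈ Ioo a b) : clamp a b =ᶠ[𝓝 x] id := by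
  filter_upwards [Ioo_mem_nhds h.1 h.2] with y hy using clamp_of_mem (Ioo_subset_Icc_self hy)

namespace IsStefanSolution

variable {P : StefanParams} {T : ℝ → ℝ → ℝ} {s q U : ℝ → ℝ} {a : ℝ} {b : EReal}

theorem hasDerivAt_space (h : IsStefanSolution P T s q U a b) {x t : ℝ} (ht : a < t)
    (htb : (t : EReal) < b) (hx : 0 < x) (hxs : x < s t) :
    HasDerivAt (fun y => T y t) (spaceDeriv T s x t) x :=
  ((h.T_diff_x t ht htb x ⟨hx.le, hxs.le⟩).hasDerivWithinAt).hasDerivAt (Icc_mem_nhds hx hxs)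

theorem s_cont_lt (h : IsStefanSolution P T s q U a b) {t : ℝ} (ht : a < t)
    (htb : (t : EReal) < b) : ContinuousAt s t := (h.interface t ht htb).continuousAt

theorem isOpen_interior (h : IsStefanSolution P T s q U a b) :
    IsOpen {p : ℝ × ℝ | a < p.2 ∧ (p.2 : EReal) < b ∧ 0 < p.1 ∧ p.1 < s p.2} := by
  have hO : IsOpen {p : ℝ × ℝ | a < p.2 ∧ (p.2 : EReal) < b} :=
    (isOpen_lt continuous_const continuous_snd).inter
      (isOpen_lt (continuous_coe_real_ereal.comp continuous_snd) continuous_const)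
  have hf : ContinuousOn (fun p : ℝ × ℝ => (p.1, s p.2 - p.1)) {p | a < p.2 ∧ (p.2 : EReal) < b} := by
    intro p hp
    have := (h.s_cont_lt hp.1 hp.2).comp (f := fun p : ℝ × ℝ => p.2) (x := p) continuousAt_snd
    exact (continuousAt_fst.prodMk (this.sub continuousAt_fst)).continuousWithinAt
  have := hf.isOpen_inter_preimage hO (isOpen_Ioi (a := (0 : ℝ)) |>.prod (isOpen_Ioi (a := (0 : ℝ))))
  convert this using 1
  ext p
  simp [and_assoc]

/-- Derivative of `∫ φ(T - Tm)` in the normalised variable. -/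
theorem hasDerivAt_integral_normalized (h : IsStefanSolution P T s q U a b) {φ φ₁ φ₂ : ℝ → ℝ}
    (hφ : ∀ x, HasDerivAt φ (φ₁ x) x) (hφ₁ : ∀ x, HasDerivAt φ₁ (φ₂ x) x) (hφ₂ : Continuous φ₂)
    {t : ℝ} (ht : a < t) (htb : (t : EReal) < b) :
    HasDerivAt (fun r => ∫ y in (0 : ℝ)..1, φ (T (y * s r) r - P.Tm))
      (P.α / s t * (φ₁ (T (s t) t - P.Tm) * spaceDeriv T s (s t) t
          - φ₁ (T 0 t - P.Tm) * spaceDeriv T s 0 t)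
        - P.α * (∫ y in (0 : ℝ)..1, φ₂ (T (y * s t) t - P.Tm) * spaceDeriv T s (y * s t) t ^ 2)
        + -P.β * spaceDeriv T s (s t) t *
          ∫ y in (0 : ℝ)..1, φ₁ (T (y * s t) t - P.Tm) * (y * spaceDeriv T s (y * s t) t)) t := by
  obtain ⟨t₁, hat₁, ht₁⟩ := exists_between ht
  obtain ⟨t₂, ht₂, ht₂b⟩ := EReal.lt_iff_exists_real_btwn.1 htb
  have ht₂ : t < t₂ := EReal.coe_lt_coe_iff.1 ht₂
  have h12 : t₁ ≤ t₂ := (ht₁.trans ht₂).le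
  have htm : t ∈ Ioo t₁ t₂ := ⟨ht₁, ht₂⟩
  have hin : ∀ r ∈ Icc t₁ t₂, a < r ∧ (r : EReal) < b := fun r hr =>
    ⟨hat₁.trans_le hr.1, (EReal.coe_le_coe_iff.2 hr.2).trans_lt ht₂b⟩
  -- Clamping space and time extends `T` and `T_x` to continuous functions on the whole plane, as
  -- the fixed-interval identity requires, without changing them near the points used.
  let k : ℝ → ℝ := clamp 0 1
  let j : ℝ → ℝ := clamp t₁ t₂
  have hk : ∀ y, k y ∈ Icc (0 : ℝ) 1 := clamp_mem zero_le_one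
  have hj : ∀ r, j r ∈ Icc t₁ t₂ := clamp_mem h12
  have hl : Continuous fun r => s (j r) :=
    ContinuousOn.comp_continuous (s := Icc t₁ t₂)
      (fun r hr => (h.s_cont_lt (hin r hr).1 (hin r hr).2).continuousWithinAt)
      (continuous_clamp _ _) hj
  have hspos : ∀ r ∈ Icc t₁ t₂, 0 < s r := fun r hr => h.s_pos r (hin r hr).1.le (hin r hr).2
  have hmap : Continuous fun p : ℝ × ℝ => (k p.1 * s (j p.2), j p.2) := by
    have h1 : Continuous fun p : ℝ × ℝ => s (j p.2) := hl.comp continuous_snd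
    have h2 : Continuous fun p : ℝ × ℝ => k p.1 := (continuous_clamp 0 1).comp continuous_fst
    have h3 : Continuous fun p : ℝ × ℝ => j p.2 := (continuous_clamp t₁ t₂).comp continuous_snd
    exact (h2.mul h1).prodMk h3
  have hrange : ∀ p : ℝ × ℝ, a < j p.2 ∧ (j p.2 : EReal) < b ∧ 0 ≤ k p.1 * s (j p.2) ∧
      k p.1 * s (j p.2) ≤ s (j p.2) := fun p =>
    have hs := hspos _ (hj p.2)
    ⟨(hin _ (hj _)).1, (hin _ (hj _)).2, mul_nonneg (hk _).1 hs.le,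
      mul_le_of_le_one_left hs.le (hk _).2⟩
  have hv : Continuous fun p : ℝ × ℝ => T (k p.1 * s (j p.2)) (j p.2) - P.Tm :=
    (h.T_cont.comp_continuous hmap fun p =>
      ⟨(hrange p).1.le, (hrange p).2⟩).sub continuous_const
  have hw : Continuous fun p : ℝ × ℝ => spaceDeriv T s (k p.1 * s (j p.2)) (j p.2) :=
    h.Tx_cont.comp_continuous hmap hrange
  have hmem : ∀ y ∈ Ioo (0 : ℝ) 1, ∀ r ∈ Ioo t₁ t₂,
      a < r ∧ (r : EReal) < b ∧ 0 < y * s r ∧ y * s r < s r := fun y hy r hr => by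
    have hr' := Ioo_subset_Icc_self hr
    have hs := hspos r hr'
    exact ⟨(hin r hr').1, (hin r hr').2, mul_pos hy.1 hs, mul_lt_of_lt_one_left hs hy.2⟩
  have hz : ContinuousOn (fun p : ℝ × ℝ =>
      deriv (fun y => spaceDeriv T s y p.2) (p.1 * s p.2)) (Ioo 0 1 ×ˢ Ioo t₁ t₂) := by
    refine h.Txx_cont.comp (f := fun p : ℝ × ℝ => (p.1 * s p.2, p.2)) ?_
      fun p hp => hmem p.1 hp.1 p.2 hp.2
    intro p hp
    have hr := hin p.2 (Ioo_subset_Icc_self hp.2)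
    have := (h.s_cont_lt hr.1 hr.2).comp (f := fun p : ℝ × ℝ => p.2) (x := p) continuousAt_snd
    exact ((continuousAt_fst.mul this).prodMk continuousAt_snd).continuousWithinAt
  have hkj : ∀ y ∈ Ioo (0 : ℝ) 1, k y = y := fun y hy => clamp_of_mem (Ioo_subset_Icc_self hy)
  have hjr : ∀ r ∈ Ioo t₁ t₂, j r = r := fun r hr => clamp_of_mem (Ioo_subset_Icc_self hr)
  have key := hasDerivAt_integral_comp_of_transported_heat (t₁ := t₁) (t₂ := t₂) (α := P.α)
    (v := fun y r => T (k y * s (j r)) (j r) - P.Tm)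
    (w := fun y r => spaceDeriv T s (k y * s (j r)) (j r))
    (z := fun y r => deriv (fun x => spaceDeriv T s x r) (y * s r))
    (l := fun r => s (j r)) (m := fun r => -P.β * spaceDeriv T s (k 1 * s (j r)) (j r))
    hv hw hz hl (fun r => (hspos _ (hj r)).ne')
    ((hw.comp (f := fun r : ℝ => ((1 : ℝ), r)) (by fun_prop)).const_mul _) ?_ ?_ ?_ hφ hφ₁ hφ₂ htm
  · have hk0 : k 0 = 0 := clamp_of_mem ⟨le_rfl, zero_le_one⟩
    have hk1 : k 1 = 1 := clamp_of_mem ⟨zero_le_one, le_rfl⟩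
    simp only [hk0, hk1, hjr t htm, one_mul, zero_mul] at key
    have hcongr : ∀ f : ℝ → ℝ, (∫ y in (0 : ℝ)..1, f (k y)) = ∫ y in (0 : ℝ)..1, f y := by
      intro f
      refine intervalIntegral.integral_congr fun y hy => ?_
      rw [uIcc_of_le zero_le_one] at hy
      simp only [k, clamp_of_mem hy]
    refine (key.congr_deriv ?_).congr_of_eventuallyEq ?_
    · rw [← hcongr fun y => φ₂ (T (y * s t) t - P.Tm) * spaceDeriv T s (y * s t) t ^ 2,
        ← hcongr fun y => φ₁ (T (y * s t) t - P.Tm) * (y * spaceDeriv T s (y * s t) t)]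
      congr 2
      refine intervalIntegral.integral_congr fun y hy => ?_
      rw [uIcc_of_le zero_le_one] at hy
      simp only [k, clamp_of_mem hy]
    · filter_upwards [Ioo_mem_nhds ht₁ ht₂] with r hr
      rw [← hcongr fun y => φ (T (y * s r) r - P.Tm)]
      simp only [hjr r hr]
  · intro y hy r hr
    obtain ⟨h1, h2, h3, h4⟩ := hmem y hy r hr
    simp only [hjr r hr, hkj y hy]
    have hd := ((h.hasDerivAt_space h1 h2 h3 h4).comp y
      ((hasDerivAt_id y).mul_const (s r))).sub_const P.Tm
    refine (hd.congr_deriv (by simp [mul_comm])).congr_of_eventuallyEq ?_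
    filter_upwards [clamp_eventuallyEq hy] with x hx
    simp only [k, hx]; rfl
  · intro y hy r hr
    obtain ⟨h1, h2, h3, h4⟩ := hmem y hy r hr
    simp only [hjr r hr]
    have hd := ((h.T_diff_xx r (y * s r) h1 h2 h3 h4).hasDerivAt).comp y
      ((hasDerivAt_id y).mul_const (s r))
    refine (hd.congr_deriv (by simp [mul_comm])).congr_of_eventuallyEq ?_
    filter_upwards [clamp_eventuallyEq hy] with x hx
    simp only [k, hx]; rfl
  · intro y hy r hr
    obtain ⟨h1, h2, h3, h4⟩ := hmem y hy r hr
    have hk1 : k 1 = 1 := clamp_of_mem ⟨zero_le_one, le_rfl⟩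
    simp only [hjr r hr, hkj y hy, hk1, one_mul]
    have hd := (hasDerivAt_comp_graph (f := T) (f₁ := spaceDeriv T s)
      (f₂ := fun x t => deriv (fun r => T x r) t) (g := fun r => y * s r) h.isOpen_interior
      (show (y * s r, r) ∈ _ from ⟨h1, h2, h3, h4⟩)
      (fun p hp => h.hasDerivAt_space hp.1 hp.2.1 hp.2.2.1 hp.2.2.2)
      (fun p hp => (h.T_diff_t p.2 p.1 hp.1 hp.2.1 hp.2.2.1 hp.2.2.2).hasDerivAt)
      (h.Tx_cont.mono fun p hp => ⟨hp.1, hp.2.1, hp.2.2.1.le, hp.2.2.2.le⟩) h.Tt_cont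
      ((h.interface r h1 h2).const_mul y)).sub_const P.Tm
    refine (hd.congr_deriv ?_).congr_of_eventuallyEq ?_
    · rw [h.heat r (y * s r) h1 h2 h3 h4]; ring
    · filter_upwards [clamp_eventuallyEq hr] with x hx
      simp only [j, hx]; rfl

end IsStefanSolution

/-! ### Differential inequalities with right derivatives. -/

/-- The left end point carries only continuity, matching solutions whose equations hold only for
positive elapsed time; it is reached as a limit of interior starting points. -/
theorem le_of_right_deriv_nonpos {f f' : ℝ → ℝ} {a b : ℝ} (hab : a ≤ b)
    (hf : ContinuousOn f (Icc a b))
    (hd : ∀ t ∈ Ioo a b, HasDerivWithinAt f (f' t) (Ici t) t)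
    (hn : ∀ t ∈ Ioo a b, f' t ≤ 0) : f b ≤ f a := by
  rcases hab.eq_or_lt with rfl | hlt
  · exact le_rfl
  have hc : ∀ c ∈ Ioo a b, f b ≤ f c := fun c hc =>
    image_le_of_deriv_right_le_deriv_boundary (f' := f') (B := fun _ => f c) (B' := fun _ => 0)
      (hf.mono (Icc_subset_Icc_left hc.1.le)) (fun t ht => hd t ⟨hc.1.trans_le ht.1, ht.2⟩) le_rfl
      continuousOn_const (fun t _ => hasDerivWithinAt_const t _ _)
      (fun t ht => hn t ⟨hc.1.trans_le ht.1, ht.2⟩) ⟨hc.2.le, le_rfl⟩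
  have ht : Tendsto f (𝓝[Ioo a b] a) (𝓝 (f a)) :=
    (hf a ⟨le_rfl, hab⟩).mono Ioo_subset_Icc_self
  have : (𝓝[Ioo a b] a).NeBot := by
    rw [nhdsWithin_Ioo_eq_nhdsGT hlt]; infer_instance
  exact ge_of_tendsto ht (by filter_upwards [self_mem_nhdsWithin] with c h using hc c h)

/-- A function whose right derivative agrees with that of `g` differs from it by a constant. -/
theorem sub_eq_sub_of_right_deriv_eq {f g f' : ℝ → ℝ} {a b : ℝ} (hab : a ≤ b)
    (hf : ContinuousOn f (Icc a b)) (hg : ContinuousOn g (Icc a b))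
    (hfd : ∀ t ∈ Ioo a b, HasDerivWithinAt f (f' t) (Ici t) t)
    (hgd : ∀ t ∈ Ioo a b, HasDerivWithinAt g (f' t) (Ici t) t) : f b - f a = g b - g a := by
  have h1 := le_of_right_deriv_nonpos hab (hf.sub hg)
    (fun t ht => (hfd t ht).sub (hgd t ht)) (fun t _ => by simp)
  have h2 := le_of_right_deriv_nonpos hab (hg.sub hf)
    (fun t ht => (hgd t ht).sub (hfd t ht)) (fun t _ => by simp)
  simp only [Pi.sub_apply] at h1 h2
  linarith

/-- Grönwall's inequality for right derivatives. -/
theorem le_exp_of_right_deriv_le {f f' : ℝ → ℝ} {a b c : ℝ} (hab : a ≤ b)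
    (hf : ContinuousOn f (Icc a b))
    (hd : ∀ t ∈ Ioo a b, HasDerivWithinAt f (f' t) (Ici t) t)
    (hn : ∀ t ∈ Ioo a b, f' t ≤ -c * f t) : f b ≤ f a * Real.exp (-c * (b - a)) := by
  have key := le_of_right_deriv_nonpos (f := fun t => f t * Real.exp (c * (t - a)))
    (f' := fun t => f' t * Real.exp (c * (t - a)) + f t * (Real.exp (c * (t - a)) * c)) hab
    (hf.mul (by fun_prop)) (fun t ht => ?_) (fun t ht => ?_)
  · simp only [sub_self, mul_zero, Real.exp_zero, mul_one] at key
    calc f b = f b * Real.exp (c * (b - a)) * Real.exp (-c * (b - a)) := by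
          rw [mul_assoc, ← Real.exp_add]; simp
      _ ≤ _ := mul_le_mul_of_nonneg_right key (Real.exp_pos _).le
  · refine (hd t ht).mul ?_
    have := (((hasDerivAt_id t).sub_const a).const_mul c).exp
    simpa using this.hasDerivWithinAt
  · have := mul_le_mul_of_nonneg_right (hn t ht) (Real.exp_pos (c * (t - a))).le
    nlinarith

/-- A solution of `f' ≥ -c f` which starts nonnegative stays nonnegative. -/
theorem nonneg_of_right_deriv_ge {f f' : ℝ → ℝ} {a b c : ℝ} (hab : a ≤ b)
    (hf : ContinuousOn f (Icc a b))
    (hd : ∀ t ∈ Ioo a b, HasDerivWithinAt f (f' t) (Ici t) t)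
    (hn : ∀ t ∈ Ioo a b, -c * f t ≤ f' t) (h0 : 0 ≤ f a) : 0 ≤ f b := by
  have := le_exp_of_right_deriv_le (f := -f) (f' := fun t => -f' t) (c := c) hab hf.neg
    (fun t ht => (hd t ht).neg) (fun t ht => by have := hn t ht; simp only [Pi.neg_apply]; linarith)
  have h2 := mul_nonneg h0 (Real.exp_pos (-c * (b - a))).le
  simp only [Pi.neg_apply] at this
  linarith

/-! ### Energy identities on the moving domain and the maximum principle. -/

namespace IsStefanSolution

variable {P : StefanParams} {T : ℝ → ℝ → ℝ} {s q U : ℝ → ℝ} {a : ℝ} {b : EReal}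

theorem Icc_subset (_h : IsStefanSolution P T s q U a b) {c : ℝ} (hc : (c : EReal) < b) :
    Icc a c ⊆ {t : ℝ | a ≤ t ∧ (t : EReal) < b} := fun _ ht =>
  ⟨ht.1, (EReal.coe_le_coe_iff.2 ht.2).trans_lt hc⟩

theorem continuousOn_T (h : IsStefanSolution P T s q U a b) {t : ℝ} (ht : a ≤ t)
    (htb : (t : EReal) < b) : ContinuousOn (fun x => T x t) (Icc 0 (s t)) :=
  h.T_cont.comp (f := fun x => (x, t)) (by fun_prop) fun _ hx => ⟨ht, htb, hx.1, hx.2⟩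

theorem continuousOn_spaceDeriv (h : IsStefanSolution P T s q U a b) {t : ℝ} (ht : a < t)
    (htb : (t : EReal) < b) : ContinuousOn (fun x => spaceDeriv T s x t) (Icc 0 (s t)) :=
  h.Tx_cont.comp (f := fun x => (x, t)) (by fun_prop) fun _ hx => ⟨ht, htb, hx.1, hx.2⟩

theorem continuousOn_integral (h : IsStefanSolution P T s q U a b) {φ : ℝ → ℝ}
    (hφ : Continuous φ) {c : ℝ} (hc : (c : EReal) < b) :
    ContinuousOn (fun r => ∫ x in (0 : ℝ)..s r, φ (T x r - P.Tm)) (Icc a c) := by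
  rcases lt_or_ge c a with hca | hac
  · rw [Icc_eq_empty hca.not_ge]; exact continuousOn_empty _
  let k : ℝ → ℝ := clamp 0 1
  let j : ℝ → ℝ := clamp a c
  have hk : ∀ y, k y ∈ Icc (0 : ℝ) 1 := clamp_mem zero_le_one
  have hj : ∀ r, j r ∈ Icc a c := clamp_mem hac
  have hl : Continuous fun r => s (j r) :=
    (h.s_cont.mono (h.Icc_subset hc)).comp_continuous (continuous_clamp _ _) hj
  have hspos : ∀ r ∈ Icc a c, 0 < s r := fun r hr =>
    h.s_pos r (h.Icc_subset hc hr).1 (h.Icc_subset hc hr).2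
  have hmap : Continuous fun p : ℝ × ℝ => (k p.2 * s (j p.1), j p.1) := by
    have h1 : Continuous fun p : ℝ × ℝ => s (j p.1) := hl.comp continuous_fst
    have h2 : Continuous fun p : ℝ × ℝ => k p.2 := (continuous_clamp 0 1).comp continuous_snd
    have h3 : Continuous fun p : ℝ × ℝ => j p.1 := (continuous_clamp a c).comp continuous_fst
    exact (h2.mul h1).prodMk h3
  have hv : Continuous fun p : ℝ × ℝ => T (k p.2 * s (j p.1)) (j p.1) :=
    h.T_cont.comp_continuous hmap fun p =>
      have hs := hspos _ (hj p.1)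
      ⟨(h.Icc_subset hc (hj _)).1, (h.Icc_subset hc (hj _)).2, mul_nonneg (hk _).1 hs.le,
        mul_le_of_le_one_left hs.le (hk _).2⟩
  have hI : Continuous fun r => s (j r) * ∫ y in (0 : ℝ)..1, φ (T (k y * s (j r)) (j r) - P.Tm) :=
    hl.mul (intervalIntegral.continuous_parametric_intervalIntegral_of_continuous'
      (f := fun r y => φ (T (k y * s (j r)) (j r) - P.Tm))
      (hφ.comp (hv.sub continuous_const)) 0 1)
  refine hI.continuousOn.congr fun r hr => ?_
  have hjr : j r = r := clamp_of_mem hr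
  have := intervalIntegral.mul_integral_comp_mul_right (a := 0) (b := 1) (s r)
    (f := fun x => φ (T x r - P.Tm))
  rw [zero_mul, one_mul] at this
  simp only [hjr]
  rw [← this]
  congr 1
  refine intervalIntegral.integral_congr fun y hy => ?_
  rw [uIcc_of_le zero_le_one] at hy
  simp only [k, clamp_of_mem hy]

/-- Energy identity for `∫₀^{s(t)} φ(T - Tm) dx`. -/
theorem hasDerivAt_integral (h : IsStefanSolution P T s q U a b) {φ φ₁ φ₂ : ℝ → ℝ}
    (hφ : ∀ x, HasDerivAt φ (φ₁ x) x) (hφ₁ : ∀ x, HasDerivAt φ₁ (φ₂ x) x) (hφ₂ : Continuous φ₂)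
    (hφ0 : φ 0 = 0) {t : ℝ} (ht : a < t) (htb : (t : EReal) < b) :
    HasDerivAt (fun r => ∫ x in (0 : ℝ)..s r, φ (T x r - P.Tm))
      (P.α * (φ₁ 0 * spaceDeriv T s (s t) t - φ₁ (T 0 t - P.Tm) * spaceDeriv T s 0 t)
        - P.α * ∫ x in (0 : ℝ)..s t, φ₂ (T x t - P.Tm) * spaceDeriv T s x t ^ 2) t := by
  have hφc : Continuous φ := continuous_iff_continuousAt.2 fun x => (hφ x).continuousAt
  have hφ₁c : Continuous φ₁ := continuous_iff_continuousAt.2 fun x => (hφ₁ x).continuousAt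
  have hs := h.s_pos t ht.le htb
  have hI := (h.interface t ht htb).mul (h.hasDerivAt_integral_normalized hφ hφ₁ hφ₂ ht htb)
  have hfun : (fun r => ∫ x in (0 : ℝ)..s r, φ (T x r - P.Tm)) =
      s * fun r => ∫ y in (0 : ℝ)..1, φ (T (y * s r) r - P.Tm) := by
    ext r
    have := intervalIntegral.mul_integral_comp_mul_right (a := 0) (b := 1) (s r)
      (f := fun x => φ (T x r - P.Tm))
    rw [zero_mul, one_mul] at this
    exact this.symm
  rw [hfun]
  refine hI.congr_deriv ?_
  have e0 := intervalIntegral.mul_integral_comp_mul_right (a := 0) (b := 1) (s t)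
      (f := fun x => φ (T x t - P.Tm))
  have e1 := intervalIntegral.mul_integral_comp_mul_right (a := 0) (b := 1) (s t)
      (f := fun x => φ₁ (T x t - P.Tm) * (x * spaceDeriv T s x t))
  have e2 := intervalIntegral.mul_integral_comp_mul_right (a := 0) (b := 1) (s t)
      (f := fun x => φ₂ (T x t - P.Tm) * spaceDeriv T s x t ^ 2)
  rw [zero_mul, one_mul] at e0 e1 e2
  have e1' : (∫ y in (0 : ℝ)..1, φ₁ (T (y * s t) t - P.Tm) *
      (y * s t * spaceDeriv T s (y * s t) t)) =
      s t * ∫ y in (0 : ℝ)..1, φ₁ (T (y * s t) t - P.Tm) * (y * spaceDeriv T s (y * s t) t) := by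
    rw [← intervalIntegral.integral_const_mul]
    exact intervalIntegral.integral_congr fun y _ => by ring
  have hTc := (h.continuousOn_T ht.le htb).sub (continuousOn_const (c := P.Tm))
  have hwc := h.continuousOn_spaceDeriv ht htb
  have hi0 : IntervalIntegrable (fun x => φ (T x t - P.Tm)) volume 0 (s t) :=
    ContinuousOn.intervalIntegrable_of_Icc hs.le (hφc.comp_continuousOn hTc)
  have hi1 : IntervalIntegrable (fun x => φ₁ (T x t - P.Tm) * (x * spaceDeriv T s x t))
      volume 0 (s t) :=
    ContinuousOn.intervalIntegrable_of_Icc hs.le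
      ((hφ₁c.comp_continuousOn hTc).mul (continuousOn_id.mul hwc))
  -- The integrand is the derivative of `x φ(T - Tm)`, which vanishes at both ends because `φ 0 =
  -- 0`. This cancels all terms in the interface velocity produced by rescaling.
  have hparts : (∫ x in (0 : ℝ)..s t, (φ (T x t - P.Tm) +
      φ₁ (T x t - P.Tm) * (x * spaceDeriv T s x t))) = 0 := by
    rw [intervalIntegral.integral_eq_sub_of_hasDerivAt_of_le hs.le
      (f := fun x => x * φ (T x t - P.Tm)) (continuousOn_id.mul (hφc.comp_continuousOn hTc))
      (fun x hx => ?_) (hi0.add hi1)]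
    · simp [h.melt t ht htb, hφ0]
    · have h1 := (hasDerivAt_id x).mul ((hφ (T x t - P.Tm)).comp x
        ((h.hasDerivAt_space ht htb hx.1 hx.2).sub_const P.Tm))
      refine h1.congr_deriv ?_
      simp only [Function.comp_apply, id]; ring
  rw [intervalIntegral.integral_add hi0 hi1, ← e0, ← e1, e1'] at hparts
  rw [← e2, h.melt t ht htb, sub_self]
  generalize (∫ y in (0 : ℝ)..1, φ (T (y * s t) t - P.Tm)) = I0 at *
  generalize (∫ y in (0 : ℝ)..1, φ₁ (T (y * s t) t - P.Tm) *
    (y * spaceDeriv T s (y * s t) t)) = I1 at *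
  generalize (∫ y in (0 : ℝ)..1, φ₂ (T (y * s t) t - P.Tm) *
    spaceDeriv T s (y * s t) t ^ 2) = I2 at *
  have hI0 : I0 = -(s t * I1) := by
    have : s t * (I0 + s t * I1) = 0 := by linarith
    rcases mul_eq_zero.1 this with h0 | h0
    · exact absurd h0 hs.ne'
    · linarith
  rw [hI0]
  field_simp
  ring

/-- Conservation of energy: with `φ = x`, the heat flux leaving at the interface cancels against the
latent heat `(k/β) s'`, leaving only the boundary input. -/
theorem hasDerivAt_energyDeficit (h : IsStefanSolution P T s q U a b) (hk : P.k ≠ 0)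
    (hα : P.α ≠ 0) (hβ : P.β ≠ 0) (sr : ℝ) {t : ℝ} (ht : a < t) (htb : (t : EReal) < b) :
    HasDerivAt (energyDeficit P sr T s) (-q t) t := by
  have h1 := h.hasDerivAt_integral (φ := fun x => x) (φ₁ := fun _ => 1) (φ₂ := fun _ => 0)
    (fun x => hasDerivAt_id x) (fun x => hasDerivAt_const x 1) continuous_const rfl ht htb
  have h2 := ((h1.const_mul (P.k / P.α)).add
    (((h.interface t ht htb).sub_const sr).const_mul (P.k / P.β))).neg
  refine h2.congr_deriv ?_
  rw [← h.flux t ht htb]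
  simp only [zero_mul, intervalIntegral.integral_zero]
  field_simp
  ring

theorem continuousOn_energyDeficit (h : IsStefanSolution P T s q U a b) (sr : ℝ) {c : ℝ}
    (hc : (c : EReal) < b) : ContinuousOn (energyDeficit P sr T s) (Icc a c) := by
  have h1 := h.continuousOn_integral continuous_id hc
  have h2 := h.s_cont.mono (h.Icc_subset hc)
  exact ((h1.const_mul _).add ((h2.sub continuousOn_const).const_mul _)).neg

/-- The temperature stays above melting while the boundary heat flux is nonnegative. -/
theorem melting_le (h : IsStefanSolution P T s q U a b) (hk : 0 < P.k) (hα : 0 < P.α)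
    {c : ℝ} (hac : a ≤ c) (hc : (c : EReal) < b) (hq : ∀ t ∈ Icc a c, 0 ≤ q t)
    (h0 : ∀ x ∈ Icc 0 (s a), P.Tm ≤ T x a) : ∀ x ∈ Icc 0 (s c), P.Tm ≤ T x c := by
  have hder : ∀ n : ℕ, ∀ x : ℝ, HasDerivAt (fun x => min x 0 ^ (n + 2))
      ((n + 2) * min x 0 ^ (n + 1)) x := by
    intro n x
    have hne : ∀ y : ℝ, y ≠ 0 → HasDerivAt (fun x : ℝ => min x 0 ^ (n + 2))
        ((n + 2) * min y 0 ^ (n + 1)) y := by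
      intro y hy
      rcases hy.lt_or_gt with hy | hy
      · have := hasDerivAt_pow (n + 2) y
        rw [min_eq_left hy.le]
        refine (this.congr_deriv (by simp)).congr_of_eventuallyEq ?_
        filter_upwards [Iio_mem_nhds hy] with z hz
        rw [min_eq_left (le_of_lt hz)]
      · rw [min_eq_right hy.le]
        refine ((hasDerivAt_const y (0 : ℝ)).congr_deriv (by simp)).congr_of_eventuallyEq ?_
        filter_upwards [Ioi_mem_nhds hy] with z hz
        rw [min_eq_right (le_of_lt hz)]; simp
    rcases eq_or_ne x 0 with rfl | hx
    · exact hasDerivAt_of_hasDerivAt_of_ne (g := fun y => (n + 2) * min y 0 ^ (n + 1)) hne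
        (by fun_prop) (by fun_prop)
    · exact hne x hx
  -- The fourth power is the lowest even one for which the negative part is `C²`. Its derivative
  -- vanishes at `0`, which removes the interface term.
  have hd := fun t (ht : t ∈ Ioo a c) => h.hasDerivAt_integral (φ := fun x => min x 0 ^ 4)
    (φ₁ := fun x => 4 * min x 0 ^ 3) (φ₂ := fun x => 4 * (3 * min x 0 ^ 2))
    (fun x => (hder 2 x).congr_deriv (by norm_num))
    (fun x => ((hder 1 x).const_mul 4).congr_deriv (by norm_num)) (by fun_prop) (by simp) ht.1
    (h.Icc_subset hc (Ioo_subset_Icc_self ht)).2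
  have hle := le_of_right_deriv_nonpos hac
    (h.continuousOn_integral (φ := fun x => min x 0 ^ 4) (by fun_prop) hc)
    (fun t ht => (hd t ht).hasDerivWithinAt) (fun t ht => by
      have htb := (h.Icc_subset hc (Ioo_subset_Icc_self ht)).2
      have hs := h.s_pos t ht.1.le htb
      have hI : 0 ≤ ∫ x in (0 : ℝ)..s t, 4 * (3 * min (T x t - P.Tm) 0 ^ 2) *
          spaceDeriv T s x t ^ 2 :=
        intervalIntegral.integral_nonneg hs.le fun x _ => by positivity
      have hfl := h.flux t ht.1 htb
      have hx : spaceDeriv T s 0 t ≤ 0 := by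
        have := hq t (Ioo_subset_Icc_self ht)
        by_contra! hcon
        nlinarith
      have hm : min (T 0 t - P.Tm) 0 ^ 3 ≤ 0 := by
        have : min (T 0 t - P.Tm) 0 ≤ 0 := min_le_right _ _
        exact Odd.pow_nonpos (by decide) this
      -- At the fixed boundary both factors are nonpositive, so heating can only reduce the energy
      -- of the negative part.
      have h1 : 0 ≤ P.α * (min (T 0 t - P.Tm) 0 ^ 3 * spaceDeriv T s 0 t) :=
        mul_nonneg hα.le (mul_nonneg_of_nonpos_of_nonpos hm hx)
      have h2 := mul_nonneg hα.le hI
      simp only [min_self]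
      nlinarith)
  have hsa := h.s_pos a le_rfl ((EReal.coe_le_coe_iff.2 hac).trans_lt hc)
  have hsc := h.s_pos c hac hc
  have hz : (∫ x in (0 : ℝ)..s a, min (T x a - P.Tm) 0 ^ 4) = 0 := by
    rw [intervalIntegral.integral_congr (g := fun _ => 0), intervalIntegral.integral_zero]
    intro x hx
    rw [uIcc_of_le hsa.le] at hx
    simp [min_eq_right (sub_nonneg.2 (h0 x hx))]
  rw [hz] at hle
  intro x hx
  by_contra! hneg
  have hcont : ContinuousOn (fun x => min (T x c - P.Tm) 0 ^ 4) (Icc 0 (s c)) := by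
    have hTc := (h.continuousOn_T hac hc).sub (continuousOn_const (c := P.Tm))
    exact (show Continuous fun x : ℝ => min x 0 ^ 4 by fun_prop).comp_continuousOn hTc
  have hpos := intervalIntegral.integral_pos hsc hcont (fun x _ => by positivity)
    ⟨x, hx, by
      have : min (T x c - P.Tm) 0 < 0 := min_lt_of_left_lt (by linarith)
      have := this.ne
      positivity⟩
  linarith

end IsStefanSolution

/-! ### Restarted solutions and motions with held input. -/

namespace IsStefanSolution

variable {P : StefanParams} {T : ℝ → ℝ → ℝ} {s q U : ℝ → ℝ} {a : ℝ} {b : EReal}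

theorem restrict (h : IsStefanSolution P T s q U a b) {U' : ℝ → ℝ} {a' : ℝ} {b' : EReal}
    (ha : a ≤ a') (hb : b' ≤ b) (hU : ∀ t : ℝ, a' ≤ t → (t : EReal) < b' → U t = U' t) :
    IsStefanSolution P T s q U' a' b' where
  s_pos t h1 h2 := h.s_pos t (ha.trans h1) (h2.trans_le hb)
  s_cont := h.s_cont.mono fun _ ht => ⟨ha.trans ht.1, ht.2.trans_le hb⟩
  T_cont := h.T_cont.mono fun _ ht => ⟨ha.trans ht.1, ht.2.1.trans_le hb, ht.2.2⟩
  T_diff_x t h1 h2 := h.T_diff_x t (ha.trans_lt h1) (h2.trans_le hb)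
  Tx_cont := h.Tx_cont.mono fun _ ht => ⟨ha.trans_lt ht.1, ht.2.1.trans_le hb, ht.2.2⟩
  T_diff_xx t x h1 h2 := h.T_diff_xx t x (ha.trans_lt h1) (h2.trans_le hb)
  T_diff_t t x h1 h2 := h.T_diff_t t x (ha.trans_lt h1) (h2.trans_le hb)
  Tt_cont := h.Tt_cont.mono fun _ ht => ⟨ha.trans_lt ht.1, ht.2.1.trans_le hb, ht.2.2⟩
  Txx_cont := h.Txx_cont.mono fun _ ht => ⟨ha.trans_lt ht.1, ht.2.1.trans_le hb, ht.2.2⟩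
  heat t x h1 h2 := h.heat t x (ha.trans_lt h1) (h2.trans_le hb)
  flux t h1 h2 := h.flux t (ha.trans_lt h1) (h2.trans_le hb)
  melt t h1 h2 := h.melt t (ha.trans_lt h1) (h2.trans_le hb)
  interface t h1 h2 := h.interface t (ha.trans_lt h1) (h2.trans_le hb)
  q_cont := h.q_cont.mono fun _ ht => ⟨ha.trans ht.1, ht.2.trans_le hb⟩
  actuator t h1 h2 := hU t h1 h2 ▸ h.actuator t (ha.trans h1) (h2.trans_le hb)

theorem q_eq_of_const (h : IsStefanSolution P T s q U a b) {u : ℝ}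
    (hU : ∀ t : ℝ, a ≤ t → (t : EReal) < b → U t = u) {t : ℝ} (ht : a ≤ t)
    (htb : (t : EReal) < b) : q t = q a + u * (t - a) := by
  have := sub_eq_sub_of_right_deriv_eq (f := q) (g := fun r => u * (r - a)) (f' := fun _ => u) ht
    (h.q_cont.mono (h.Icc_subset htb)) (by fun_prop)
    (fun r hr => by
      have hr' := h.Icc_subset htb (Ioo_subset_Icc_self hr)
      exact hU r hr'.1 hr'.2 ▸ h.actuator r hr'.1 hr'.2)
    (fun r _ => by
      simpa using (((hasDerivAt_id r).sub_const a).const_mul u).hasDerivWithinAt)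
  simp only [sub_self, mul_zero, sub_zero] at this
  linarith

theorem energyDeficit_eq_of_const (h : IsStefanSolution P T s q U a b) (hk : P.k ≠ 0)
    (hα : P.α ≠ 0) (hβ : P.β ≠ 0) (sr : ℝ) {u : ℝ}
    (hU : ∀ t : ℝ, a ≤ t → (t : EReal) < b → U t = u) {t : ℝ} (ht : a ≤ t)
    (htb : (t : EReal) < b) :
    energyDeficit P sr T s t = energyDeficit P sr T s a - q a * (t - a) - u * (t - a) ^ 2 / 2 := by
  have := sub_eq_sub_of_right_deriv_eq (f := energyDeficit P sr T s)
    (g := fun r => -(q a * (r - a)) - u * (r - a) ^ 2 / 2) (f' := fun r => -q r) ht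
    (h.continuousOn_energyDeficit sr htb) (by fun_prop)
    (fun r hr => by
      have hr' := h.Icc_subset htb (Ioo_subset_Icc_self hr)
      exact (h.hasDerivAt_energyDeficit hk hα hβ sr hr.1 hr'.2).hasDerivWithinAt)
    (fun r hr => by
      have hr' := h.Icc_subset htb (Ioo_subset_Icc_self hr)
      have h1 := (hasDerivAt_id r).sub_const a
      refine HasDerivAt.hasDerivWithinAt ?_
      refine (((h1.const_mul (q a)).neg).sub (((h1.pow 2).const_mul u).div_const 2)).congr_deriv ?_
      rw [h.q_eq_of_const hU hr'.1 hr'.2]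
      simp only [id]; ring)
  simp only [sub_self, mul_zero] at this
  linarith

variable {G : ETCGains} {sr : ℝ}

theorem continuousOn_barrierThree (h : IsStefanSolution P T s q U a b) {c : ℝ}
    (hc : (c : EReal) < b) : ContinuousOn (barrierThree P G sr T s q) (Icc a c) :=
  (h.q_cont.mono (h.Icc_subset hc)).neg.add ((h.continuousOn_energyDeficit sr hc).const_mul _)

theorem hasDerivWithinAt_barrierThree (h : IsStefanSolution P T s q U a b) (hk : P.k ≠ 0)
    (hα : P.α ≠ 0) (hβ : P.β ≠ 0) {t : ℝ} (ht : a < t) (htb : (t : EReal) < b) :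
    HasDerivWithinAt (barrierThree P G sr T s q) (-U t + G.c₁ * -q t) (Ici t) t :=
  (h.actuator t ht.le htb).neg.add
    ((h.hasDerivAt_energyDeficit hk hα hβ sr ht htb).hasDerivWithinAt.const_mul _)

end IsStefanSolution

/-! ### Dwell time, exclusion of Zeno behaviour, and positivity of the barriers. -/

theorem ETCGains.μ₁_pos {G : ETCGains} (hc₁ : 0 < G.c₁) (hc₂ : 0 < G.c₂) (hδ₁ : 0 < G.δ₁)
    (hδ₂' : G.δ₂ < 1) : 0 < G.μ₁ :=
  lt_min (mul_pos hδ₁ hc₁) (mul_pos (by linarith) hc₂)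

/-- For a uniform time after an event the triggering bounds hold along the held motion. -/
theorem exists_dwell_time {c₁ c₂ δ μ : ℝ} (hc₁ : 0 < c₁) (hc₂ : 0 < c₂) (hδ : 0 < δ)
    (hδ' : δ < 1) (hμ : 0 < μ) :
    ∃ τ > 0, ∀ x y u r h₂ h₃ : ℝ, 0 ≤ x → 0 ≤ y → 0 ≤ r → r < τ → u = -c₁ * x + c₂ * y →
      h₂ = x + u * r → h₃ = y - u * r - c₁ * (x * r) - c₁ * (u * r ^ 2 / 2) →
      -δ * c₂ * h₃ ≤ (-c₁ * h₂ + c₂ * h₃) - u ∧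
        (-c₁ * h₂ + c₂ * h₃) - u ≤ μ * h₂ + δ * c₂ * h₃ := by
  have hK₁ : 0 < c₁ * c₂ + 2 * c₂ * (c₂ + c₁ * c₂) := by positivity
  have hK₂ : 0 < μ * c₁ + c₁ ^ 2 + c₂ * c₁ ^ 2 := by positivity
  -- Each bound is linear in `(x, y)`. In the lower one only the coefficient of `y` needs small `r`,
  -- in the upper one only that of `x`; the two quotients handle these, using `r² ≤ r` and `0 < δ <
  -- 1`.
  refine ⟨min 1 (min (δ * c₂ / (c₁ * c₂ + 2 * c₂ * (c₂ + c₁ * c₂)))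
    (μ / (μ * c₁ + c₁ ^ 2 + c₂ * c₁ ^ 2))), by positivity, ?_⟩
  rintro x y u r h₂ h₃ hx hy hr hrτ rfl rfl rfl
  obtain ⟨hr1, hr2⟩ := lt_min_iff.1 hrτ
  obtain ⟨hr2, hr3⟩ := lt_min_iff.1 hr2
  rw [lt_div_iff₀ hK₁] at hr2
  rw [lt_div_iff₀ hK₂] at hr3
  have hrr : r ^ 2 ≤ r := by nlinarith
  constructor
  · have e1 : 0 ≤ x * (c₁ ^ 2 * r + c₂ * (1 + δ) * c₁ ^ 2 * (r ^ 2 / 2)) := by positivity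
    have e2 : 0 ≤ δ * c₂ - c₁ * c₂ * r - c₂ * (1 + δ) * (c₂ * r + c₁ * c₂ * (r ^ 2 / 2)) := by
      have f1 : c₂ * r + c₁ * c₂ * (r ^ 2 / 2) ≤ c₂ * r + c₁ * c₂ * r := by
        have := mul_pos hc₁ hc₂
        nlinarith
      have f2 : c₂ * (1 + δ) * (c₂ * r + c₁ * c₂ * (r ^ 2 / 2)) ≤
          c₂ * 2 * (c₂ * r + c₁ * c₂ * r) :=
        mul_le_mul (by nlinarith) f1 (by positivity) (by positivity)
      nlinarith
    have := mul_nonneg hy e2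
    nlinarith
  · have e1 : 0 ≤ y * (μ * c₂ * r + c₁ * c₂ * r + δ * c₂
        + (1 - δ) * (c₂ * (c₂ * r + c₁ * c₂ * (r ^ 2 / 2)))) := by
      have : 0 ≤ 1 - δ := by linarith
      positivity
    have e2 : 0 ≤ μ * (1 - c₁ * r) - c₁ ^ 2 * r - (1 - δ) * (c₂ * c₁ ^ 2 * (r ^ 2 / 2)) := by
      have f1 : c₂ * c₁ ^ 2 * (r ^ 2 / 2) ≤ c₂ * c₁ ^ 2 * r := by
        have : 0 < c₂ * c₁ ^ 2 := by positivity
        nlinarith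
      have f2 : 0 ≤ c₂ * c₁ ^ 2 * (r ^ 2 / 2) := by positivity
      have f3 : 0 ≤ δ * (c₂ * c₁ ^ 2 * (r ^ 2 / 2)) := mul_nonneg hδ.le f2
      nlinarith
    have := mul_nonneg hx e2
    nlinarith

namespace IsClosedLoopSolution

variable {P : StefanParams} {G : ETCGains} {sr : ℝ} {T : ℝ → ℝ → ℝ} {s q U : ℝ → ℝ}
  {e : ℕ → EReal} {tEnd : EReal}

/-- Before the next event the closed-loop trajectory is itself one of the held motions admitted in
`triggerSet`, so a violation would put `t` above the infimum defining `e (j + 1)`. -/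
theorem not_triggered (h : IsClosedLoopSolution P G sr T s q U e tEnd) {j : ℕ} {a t : ℝ}
    (ha : 0 ≤ a) (hj : e j = a) (hat : a < t) (hte : (t : EReal) < e (j + 1))
    (htE : (t : EReal) < tEnd) : ¬ Triggered P G sr T s q a t := by
  intro htr
  obtain ⟨b, htb, hb⟩ := EReal.lt_iff_exists_real_btwn.1 (lt_min hte htE)
  have hsol : IsStefanSolution P T s q (fun _ => nominalControl P G sr T s q a) a b :=
    h.plant.restrict ha (hb.le.trans (min_le_right _ _)) fun r hr hrb =>
      h.hold j a hj r hr ((hrb.trans hb).trans_le (min_le_left _ _))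
        ((hrb.trans hb).trans_le (min_le_right _ _))
  have hmem : t ∈ triggerSet P G sr T s q a :=
    ⟨hat, T, s, q, b, EReal.coe_lt_coe_iff.1 htb, hsol, rfl, rfl, fun _ _ => rfl, htr⟩
  rw [h.event_succ j a hj] at hte
  exact absurd (sInf_le (mem_image_of_mem _ hmem)) hte.not_ge

theorem energyDeficit_congr {T' : ℝ → ℝ → ℝ} {s' : ℝ → ℝ} {a : ℝ} (hs0 : 0 ≤ s a)
    (hs : s' a = s a) (hT : ∀ x ∈ Icc 0 (s a), T' x a = T x a) :
    energyDeficit P sr T' s' a = energyDeficit P sr T s a := by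
  unfold energyDeficit
  rw [hs, intervalIntegral.integral_congr (g := fun x => T x a - P.Tm)]
  intro x hx
  rw [uIcc_of_le hs0] at hx
  simp only [hT x hx]

/-- Zeno behaviour is excluded, the barrier functions stay nonnegative, and the deviation of the
held input from the nominal one obeys the triggering bounds. -/
theorem barrier_bounds (h : IsClosedLoopSolution P G sr T s q U e tEnd)
    (hk : P.k ≠ 0) (hα : P.α ≠ 0) (hβ : P.β ≠ 0)
    (hc₁ : 0 < G.c₁) (hc₂ : 0 < G.c₂) (hδ₁ : 0 < G.δ₁) (hδ₂ : 0 < G.δ₂) (hδ₂' : G.δ₂ < 1)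
    (hq : 0 ≤ q 0) (hb : 0 ≤ barrierThree P G sr T s q 0) {t : ℝ} (ht : 0 ≤ t)
    (htE : (t : EReal) < tEnd) :
    0 ≤ q t ∧ 0 ≤ barrierThree P G sr T s q t ∧
      -G.δ₂ * G.c₂ * barrierThree P G sr T s q t ≤ nominalControl P G sr T s q t - U t ∧
      nominalControl P G sr T s q t - U t ≤
        G.μ₁ * q t + G.δ₂ * G.c₂ * barrierThree P G sr T s q t := by
  have hμ : 0 < G.μ₁ := G.μ₁_pos hc₁ hc₂ hδ₁ hδ₂'
  obtain ⟨τ, hτ, hdwell⟩ := exists_dwell_time hc₁ hc₂ hδ₂ hδ₂' hμ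
  set h₃ := barrierThree P G sr T s q with hh₃
  let good : ℝ → Prop := fun t =>
    -G.δ₂ * G.c₂ * h₃ t ≤ nominalControl P G sr T s q t - U t ∧
      nominalControl P G sr T s q t - U t ≤ G.μ₁ * q t + G.δ₂ * G.c₂ * h₃ t
  -- Signs propagate up to and including `e (j + 1)`, where the next step starts. The input bounds
  -- stop short of it, because `U` is updated there.
  have hstep : ∀ (j : ℕ) (a : ℝ), 0 ≤ a → e j = a → (a : EReal) < tEnd → 0 ≤ q a → 0 ≤ h₃ a →
      ((a + τ : ℝ) : EReal) ≤ e (j + 1) ∧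
      (∀ t : ℝ, a ≤ t → (t : EReal) < tEnd → (t : EReal) < e (j + 1) → good t) ∧
      ∀ t : ℝ, a ≤ t → (t : EReal) < tEnd → (t : EReal) ≤ e (j + 1) → 0 ≤ q t ∧ 0 ≤ h₃ t := by
    intro j a ha hj haE hqa hba
    have hgood : ∀ t : ℝ, a ≤ t → (t : EReal) < tEnd → (t : EReal) < e (j + 1) → good t := by
      intro t hat htE hte
      simp only [good, h.hold j a hj t hat hte htE]
      rcases hat.eq_or_lt with rfl | hat
      · rw [sub_self]
        have := mul_nonneg (mul_pos hδ₂ hc₂).le hba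
        have := mul_nonneg hμ.le hqa
        constructor <;> linarith
      · have := h.not_triggered ha hj hat hte htE
        simp only [Triggered, not_or, not_lt, gt_iff_lt] at this
        exact this
    refine ⟨?_, hgood, fun t hat htE hte => ?_⟩
    · rw [h.event_succ j a hj]
      refine le_sInf ?_
      -- Uniqueness for the Stefan problem is not needed: the triggering test sees only `q'` and
      -- `h₃`, which the held input determines from the state at `a`.
      rintro _ ⟨t, ⟨hat, T', s', q', b, htb, hsol, hs', hq', hT', htr⟩, rfl⟩
      refine EReal.coe_le_coe_iff.2 ?_
      by_contra! hlt
      have htb' : (t : EReal) < b := EReal.coe_lt_coe_iff.2 htb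
      have e0 := energyDeficit_congr (P := P) (sr := sr) (h.plant.s_pos a ha haE).le hs' hT'
      have e1 := hsol.q_eq_of_const (fun _ _ _ => rfl) hat.le htb'
      have e2 := hsol.energyDeficit_eq_of_const hk hα hβ sr (fun _ _ _ => rfl) hat.le htb'
      rw [e0, hq'] at e2
      rw [hq'] at e1
      have hN : nominalControl P G sr T' s' q' a = nominalControl P G sr T s q a := by
        simp only [nominalControl, barrierThree, hq', e0]
      have := hdwell (q a) (h₃ a) (nominalControl P G sr T s q a) (t - a) (q' t)
        (barrierThree P G sr T' s' q' t) hqa hba (by linarith) (by linarith) rfl e1 (by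
          simp only [hh₃, barrierThree, e1, e2]; ring)
      rcases htr with h1 | h1
      · rw [hN] at h1; exact absurd this.1 (not_le.2 h1)
      · rw [hN] at h1; exact absurd this.2 (not_le.2 h1)
    · have hin : ∀ r ∈ Ioo a t, a ≤ r ∧ (r : EReal) < tEnd ∧ (r : EReal) < e (j + 1) ∧ 0 < r :=
        fun r hr => ⟨hr.1.le, (EReal.coe_lt_coe_iff.2 hr.2).trans htE,
          (EReal.coe_lt_coe_iff.2 hr.2).trans_le hte, ha.trans_lt hr.1⟩
      -- The sign of `h₃` comes first: its inequality is closed, whereas that of `q` contains the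
      -- term `(1 - δ₂) c₂ h₃`.
      have hb3 : ∀ t : ℝ, a ≤ t → (t : EReal) < tEnd → (t : EReal) ≤ e (j + 1) → 0 ≤ h₃ t := by
        intro t hat htE hte
        refine nonneg_of_right_deriv_ge (c := (1 + G.δ₂) * G.c₂) hat
          ((h.plant.continuousOn_barrierThree htE).mono (Icc_subset_Icc_left ha))
          (fun r hr => h.plant.hasDerivWithinAt_barrierThree hk hα hβ (ha.trans_lt hr.1)
            ((EReal.coe_lt_coe_iff.2 hr.2).trans htE)) (fun r hr => ?_) hba
        have := (hgood r hr.1.le ((EReal.coe_lt_coe_iff.2 hr.2).trans htE)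
          ((EReal.coe_lt_coe_iff.2 hr.2).trans_le hte)).1
        simp only [nominalControl, ← hh₃] at this ⊢
        linarith
      refine ⟨?_, hb3 t hat htE hte⟩
      refine nonneg_of_right_deriv_ge (c := G.c₁ + G.μ₁) (f' := U) hat
        (h.plant.q_cont.mono ((Icc_subset_Icc_left ha).trans (h.plant.Icc_subset htE)))
        (fun r hr => h.plant.actuator r (hin r hr).2.2.2.le (hin r hr).2.1) (fun r hr => ?_) hqa
      obtain ⟨r1, r2, r3, -⟩ := hin r hr
      have h1 := (hgood r r1 r2 r3).2
      have h2 := mul_nonneg (mul_pos (sub_pos.2 hδ₂') hc₂).le (hb3 r r1 r2 r3.le)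
      simp only [nominalControl, ← hh₃] at h1
      linarith
  have hind : ∀ j : ℕ, 0 ≤ e j ∧ (e j < tEnd → ((j * τ : ℝ) : EReal) ≤ e j) ∧
      (∀ t : ℝ, 0 ≤ t → (t : EReal) < tEnd → (t : EReal) < e j → good t) ∧
      ∀ t : ℝ, 0 ≤ t → (t : EReal) < tEnd → (t : EReal) ≤ e j → 0 ≤ q t ∧ 0 ≤ h₃ t := by
    intro j
    induction j with
    | zero =>
      rw [h.event_zero]
      refine ⟨le_rfl, fun _ => by simp, fun t h1 _ h2 => ?_, fun t h1 _ h2 => ?_⟩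
      · exact absurd h2 (EReal.coe_nonneg.2 h1).not_gt
      · have : t = 0 := le_antisymm (EReal.coe_nonpos.1 h2) h1
        subst this; exact ⟨hq, hb⟩
    | succ j ih =>
      obtain ⟨i0, i1, i2, i3⟩ := ih
      rcases eq_or_ne (e j) ⊤ with htop | htop
      · have := h.event_top j htop
        rw [this]
        refine ⟨le_top, fun _ => le_top, fun t h1 h2 _ => i2 t h1 h2 ?_,
          fun t h1 h2 _ => i3 t h1 h2 ?_⟩
        · rw [htop]; exact EReal.coe_lt_top t
        · rw [htop]; exact le_top
      obtain ⟨a, hj⟩ : ∃ a : ℝ, e j = a :=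
        ⟨(e j).toReal, (EReal.coe_toReal htop (ne_bot_of_le_ne_bot EReal.zero_ne_bot i0)).symm⟩
      have ha : 0 ≤ a := EReal.coe_nonneg.1 (hj ▸ i0)
      have hmono : e j ≤ e (j + 1) := by
        rw [h.event_succ j a hj, hj]
        refine le_sInf ?_
        rintro _ ⟨t, ht, rfl⟩
        exact EReal.coe_le_coe_iff.2 ht.1.le
      rcases lt_or_ge (a : EReal) tEnd with haE | haE
      · obtain ⟨hqa, hba⟩ := i3 a ha haE hj.ge
        obtain ⟨s1, s2, s3⟩ := hstep j a ha hj haE hqa hba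
        refine ⟨i0.trans hmono, fun _ => le_trans ?_ s1, fun t h1 h2 h3 => ?_,
          fun t h1 h2 h3 => ?_⟩
        · have := i1 (hj ▸ haE)
          rw [hj, EReal.coe_le_coe_iff] at this
          refine EReal.coe_le_coe_iff.2 ?_
          push_cast
          linarith
        · rcases lt_or_ge t a with hta | hta
          · exact i2 t h1 h2 (hj ▸ EReal.coe_lt_coe_iff.2 hta)
          · exact s2 t hta h2 h3
        · rcases lt_or_ge t a with hta | hta
          · exact i3 t h1 h2 (hj ▸ (EReal.coe_lt_coe_iff.2 hta).le)
          · exact s3 t hta h2 h3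
      · refine ⟨i0.trans hmono, fun hlt => ?_, fun t h1 h2 _ => i2 t h1 h2 ?_,
          fun t h1 h2 _ => i3 t h1 h2 ?_⟩
        · exact absurd (haE.trans (hj ▸ hmono)) hlt.not_ge
        · rw [hj]; exact h2.trans_le haE
        · rw [hj]; exact (h2.trans_le haE).le
  -- By the uniform dwell time, the `n`-th event lies beyond `t` or beyond the life of the solution.
  obtain ⟨n, hn⟩ := exists_nat_gt (t / τ)
  rw [div_lt_iff₀ hτ] at hn
  have hlt : (t : EReal) < e n := by
    rcases lt_or_ge (e n) tEnd with hE | hE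
    · exact (EReal.coe_lt_coe_iff.2 hn).trans_le ((hind n).2.1 hE)
    · exact htE.trans_le hE
  obtain ⟨-, -, g1, g2⟩ := hind n
  exact ⟨(g2 t ht htE hlt.le).1, (g2 t ht htE hlt.le).2, g1 t ht htE hlt⟩

end IsClosedLoopSolution

/-! ### Cauchy–Schwarz, Poincaré and dissipation of the thermal energy. -/

theorem sq_neg_add_le (p x r y : ℝ) :
    (-(p * x + r * y)) ^ 2 ≤ 2 * p ^ 2 * x ^ 2 + 2 * r ^ 2 * y ^ 2 := by
  linarith [sq_nonneg (p * x - r * y)]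

theorem sq_intervalIntegral_le {g : ℝ → ℝ} {a b : ℝ} (hab : a ≤ b)
    (hg : ContinuousOn g (Icc a b)) :
    (∫ x in a..b, g x) ^ 2 ≤ (b - a) * ∫ x in a..b, g x ^ 2 := by
  rcases hab.eq_or_lt with rfl | hlt
  · simp
  have hl : 0 < b - a := sub_pos.2 hlt
  have h1 : IntervalIntegrable g volume a b := hg.intervalIntegrable_of_Icc hab
  have h2 : IntervalIntegrable (fun x => g x ^ 2) volume a b :=
    (hg.pow 2).intervalIntegrable_of_Icc hab
  have key : ∀ c : ℝ, 0 ≤ (∫ x in a..b, g x ^ 2) - 2 * c * (∫ x in a..b, g x) + c ^ 2 * (b - a) := by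
    intro c
    have h0 : 0 ≤ ∫ x in a..b, (g x - c) ^ 2 :=
      intervalIntegral.integral_nonneg hab fun x _ => sq_nonneg _
    have e : (∫ x in a..b, (g x - c) ^ 2) = ∫ x in a..b, (g x ^ 2 - 2 * c * g x + c ^ 2) :=
      intervalIntegral.integral_congr fun x _ => by ring
    rw [e, intervalIntegral.integral_add (h2.sub (h1.const_mul _)) intervalIntegrable_const,
      intervalIntegral.integral_sub h2 (h1.const_mul _), intervalIntegral.integral_const_mul,
      intervalIntegral.integral_const, smul_eq_mul] at h0
    linarith
  -- The optimal constant `c` is the mean of `g`.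
  have := mul_nonneg hl.le (key ((∫ x in a..b, g x) / (b - a)))
  field_simp at this
  nlinarith

namespace IsStefanSolution

variable {P : StefanParams} {T : ℝ → ℝ → ℝ} {s q U : ℝ → ℝ} {a : ℝ} {b : EReal}

/-- Poincaré's inequality for the temperature profile, which vanishes at the interface. -/
theorem sq_sub_melting_le (h : IsStefanSolution P T s q U a b) {t : ℝ} (ht : a < t)
    (htb : (t : EReal) < b) {x : ℝ} (hx : x ∈ Icc 0 (s t)) :
    (T x t - P.Tm) ^ 2 ≤ s t * ∫ y in (0 : ℝ)..s t, spaceDeriv T s y t ^ 2 := by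
  have hs := h.s_pos t ht.le htb
  have hsub : Icc x (s t) ⊆ Icc 0 (s t) := Icc_subset_Icc_left hx.1
  have hw := h.continuousOn_spaceDeriv ht htb
  have hftc : (∫ y in x..s t, spaceDeriv T s y t) = T (s t) t - T x t :=
    intervalIntegral.integral_eq_sub_of_hasDerivAt_of_le hx.2
      ((h.continuousOn_T ht.le htb).mono hsub)
      (fun y hy => h.hasDerivAt_space ht htb (hx.1.trans_lt hy.1) hy.2)
      ((hw.mono hsub).intervalIntegrable_of_Icc hx.2)
  have hcs := sq_intervalIntegral_le hx.2 (hw.mono hsub)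
  rw [hftc, h.melt t ht htb] at hcs
  have hmono : (∫ y in x..s t, spaceDeriv T s y t ^ 2) ≤
      ∫ y in (0 : ℝ)..s t, spaceDeriv T s y t ^ 2 :=
    intervalIntegral.integral_mono_interval hx.1 hx.2 le_rfl
      (ae_of_all _ fun y => sq_nonneg _) ((hw.pow 2).intervalIntegrable_of_Icc hs.le)
  have h0 : 0 ≤ ∫ y in x..s t, spaceDeriv T s y t ^ 2 :=
    intervalIntegral.integral_nonneg hx.2 fun y _ => sq_nonneg _
  calc (T x t - P.Tm) ^ 2 = (P.Tm - T x t) ^ 2 := by ring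
    _ ≤ _ := hcs
    _ ≤ _ := mul_le_mul (by linarith [hx.1]) hmono h0 hs.le

theorem integral_sq_sub_melting_le (h : IsStefanSolution P T s q U a b) {t : ℝ} (ht : a < t)
    (htb : (t : EReal) < b) :
    (∫ x in (0 : ℝ)..s t, (T x t - P.Tm) ^ 2) ≤
      s t ^ 2 * ∫ y in (0 : ℝ)..s t, spaceDeriv T s y t ^ 2 := by
  have hs := h.s_pos t ht.le htb
  have hT := (h.continuousOn_T ht.le htb).sub (continuousOn_const (c := P.Tm))
  have := intervalIntegral.integral_mono_on hs.le ((hT.pow 2).intervalIntegrable_of_Icc hs.le)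
    (intervalIntegrable_const (μ := volume)) fun x hx => h.sq_sub_melting_le ht htb hx
  rw [intervalIntegral.integral_const, smul_eq_mul] at this
  simp only [Pi.pow_apply, Pi.sub_apply] at this
  linarith

/-- Derivative of `‖T - Tm‖²` and its dissipation estimate. -/
theorem exists_hasDerivAt_integral_sq (h : IsStefanSolution P T s q U a b) (hk : 0 < P.k)
    (hα : 0 < P.α) {t R : ℝ} (ht : a < t) (htb : (t : EReal) < b) (hsR : s t ≤ R) :
    ∃ Y' : ℝ, HasDerivAt (fun r => ∫ x in (0 : ℝ)..s r, (T x r - P.Tm) ^ 2) Y' t ∧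
      Y' ≤ -(P.α / R ^ 2) * (∫ x in (0 : ℝ)..s t, (T x t - P.Tm) ^ 2)
        + P.α * R / P.k ^ 2 * q t ^ 2 := by
  have hs := h.s_pos t ht.le htb
  have hR := hs.trans_le hsR
  have hd := h.hasDerivAt_integral (φ := fun x => x ^ 2) (φ₁ := fun x => 2 * x)
    (φ₂ := fun _ => 2) (fun x => by simpa using hasDerivAt_pow 2 x)
    (fun x => by simpa using (hasDerivAt_id x).const_mul 2) continuous_const (by simp) ht htb
  refine ⟨_, hd, ?_⟩
  rw [intervalIntegral.integral_const_mul]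
  have hD : 0 ≤ ∫ y in (0 : ℝ)..s t, spaceDeriv T s y t ^ 2 :=
    intervalIntegral.integral_nonneg hs.le fun y _ => sq_nonneg _
  have h1 := h.sq_sub_melting_le ht htb (left_mem_Icc.2 hs.le)
  have h2 := h.integral_sq_sub_melting_le ht htb
  have hfl : spaceDeriv T s 0 t = -(q t / P.k) := by
    rw [← h.flux t ht htb]; field_simp
  rw [hfl]
  generalize (∫ y in (0 : ℝ)..s t, spaceDeriv T s y t ^ 2) = D at *
  generalize (∫ x in (0 : ℝ)..s t, (T x t - P.Tm) ^ 2) = Y at *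
  generalize T 0 t - P.Tm = u at *
  have h1' : u ^ 2 ≤ R * D := h1.trans (mul_le_mul_of_nonneg_right hsR hD)
  have h2' : Y / R ^ 2 ≤ D := by
    rw [div_le_iff₀ (by positivity)]
    calc Y ≤ s t ^ 2 * D := h2
      _ ≤ R ^ 2 * D := mul_le_mul_of_nonneg_right (pow_le_pow_left₀ hs.le hsR 2) hD
      _ = D * R ^ 2 := mul_comm _ _
  -- Young's inequality with weight `R`: of the dissipation `2 D`, one `D` absorbs the boundary term
  -- and the other yields decay through Poincaré.
  have h3 : 2 * u * (q t / P.k) ≤ D + R * (q t / P.k) ^ 2 := by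
    have e : 0 ≤ (u - R * (q t / P.k)) ^ 2 := sq_nonneg _
    have : R * (2 * u * (q t / P.k)) ≤ R * (D + R * (q t / P.k) ^ 2) := by nlinarith
    exact le_of_mul_le_mul_left this hR
  have h4 := mul_le_mul_of_nonneg_left h3 hα.le
  have h5 := mul_le_mul_of_nonneg_left h2' hα.le
  have e1 : -(P.α / R ^ 2) * Y = -(P.α * (Y / R ^ 2)) := by ring
  have e2 : P.α * R / P.k ^ 2 * q t ^ 2 = P.α * (R * (q t / P.k) ^ 2) := by ring
  rw [e1, e2]
  linarith

end IsStefanSolution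

/-! ### Safety and the Lyapunov estimate. -/

namespace IsClosedLoopSolution

variable {P : StefanParams} {G : ETCGains} {sr : ℝ} {T : ℝ → ℝ → ℝ} {s q U : ℝ → ℝ}
  {e : ℕ → EReal} {tEnd : EReal}

/-- The temperature stays above melting and the interface stays below the setpoint. -/
theorem safety (h : IsClosedLoopSolution P G sr T s q U e tEnd)
    (hk : 0 < P.k) (hα : 0 < P.α) (hβ : 0 < P.β)
    (hc₁ : 0 < G.c₁) (hc₂ : 0 < G.c₂) (hδ₁ : 0 < G.δ₁) (hδ₂ : 0 < G.δ₂) (hδ₂' : G.δ₂ < 1)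
    (hq : 0 ≤ q 0) (hb : 0 ≤ barrierThree P G sr T s q 0)
    (hT : ∀ x ∈ Icc 0 (s 0), P.Tm ≤ T x 0) {t : ℝ} (ht : 0 ≤ t) (htE : (t : EReal) < tEnd) :
    0 ≤ (∫ x in (0 : ℝ)..s t, (T x t - P.Tm)) ∧ 0 ≤ energyDeficit P sr T s t ∧ s t ≤ sr := by
  have hbd := fun t ht htE => h.barrier_bounds hk.ne' hα.ne' hβ.ne' hc₁ hc₂ hδ₁ hδ₂ hδ₂' hq hb
    (t := t) ht htE
  have hs := h.plant.s_pos t ht htE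
  have hle := h.plant.melting_le hk hα ht htE (fun r hr =>
    (hbd r hr.1 ((EReal.coe_le_coe_iff.2 hr.2).trans_lt htE)).1) hT
  have hI : 0 ≤ ∫ x in (0 : ℝ)..s t, (T x t - P.Tm) :=
    intervalIntegral.integral_nonneg hs.le fun x hx => sub_nonneg.2 (hle x hx)
  obtain ⟨h2, h3, -⟩ := hbd t ht htE
  have hσ : 0 ≤ energyDeficit P sr T s t := by
    simp only [barrierThree] at h3
    by_contra! hneg
    have := mul_neg_of_pos_of_neg hc₁ hneg
    linarith
  refine ⟨hI, hσ, ?_⟩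
  by_contra! hcon
  have e1 : 0 ≤ P.k / P.α * ∫ x in (0 : ℝ)..s t, (T x t - P.Tm) := by positivity
  have e2 : 0 < P.k / P.β * (s t - sr) := mul_pos (by positivity) (sub_pos.2 hcon)
  simp only [energyDeficit] at hσ
  linarith

end IsClosedLoopSolution

set_option maxHeartbeats 800000 in
theorem mainTheorem2
    (P : StefanParams) (hk : 0 < P.k) (hα : 0 < P.α) (hβ : 0 < P.β)
    (L sr : ℝ) (hsr : sr < L)
    (G : ETCGains) (hc₁ : 0 < G.c₁) (hc₂ : 0 < G.c₂) (hδ₁ : 0 < G.δ₁)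
    (hδ₂ : 0 < G.δ₂) (hδ₂' : G.δ₂ < 1) :
    ∃ M : ℝ, 0 < M ∧ ∃ b : ℝ, 0 < b ∧
      ∀ (s₀ : ℝ) (T₀ : ℝ → ℝ)
        (T : ℝ → ℝ → ℝ) (s q U : ℝ → ℝ) (e : ℕ → EReal) (tEnd : EReal),
        -- initial data
        0 < s₀ → s₀ < L →
        ContDiffOn ℝ 1 T₀ (Set.Icc 0 s₀) →
        (∀ x ∈ Set.Icc 0 s₀, P.Tm ≤ T₀ x) → T₀ s₀ = P.Tm →
        s 0 = s₀ → (∀ x ∈ Set.Ioc 0 s₀, T x 0 = T₀ x) →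
        0 ≤ q 0 →
        -- setpoint restriction
        s₀ + P.β / P.α * (∫ x in (0 : ℝ)..s₀, (T₀ x - P.Tm)) ≤ sr →
        -- gain condition
        q 0 ≤ G.c₁ * energyDeficit P sr T s 0 →
        IsClosedLoopSolution P G sr T s q U e tEnd →
        ∀ t : ℝ, 0 ≤ t → (t : EReal) < tEnd →
          stabilityNorm P sr T s q t ≤
            M * stabilityNorm P sr T s q 0 * Real.exp (-b * t) := by
  have hμ : 0 < G.μ₁ := G.μ₁_pos hc₁ hc₂ hδ₁ hδ₂'
  have hd₂ : 0 < (1 - G.δ₂) * G.c₂ := mul_pos (sub_pos.2 hδ₂') hc₂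
  -- For `sr ≤ 0` the setpoint restriction contradicts `0 < s₀`, so any constants serve.
  rcases le_or_gt sr 0 with hsr0 | hsr0
  · refine ⟨1, one_pos, 1, one_pos, ?_⟩
    intro s₀ T₀ T s q U e tEnd hs₀ _ _ hT₀ _ _ _ _ hset
    have h0 : 0 ≤ ∫ x in (0 : ℝ)..s₀, (T₀ x - P.Tm) :=
      intervalIntegral.integral_nonneg hs₀.le fun x hx => sub_nonneg.2 (hT₀ x hx)
    have : 0 ≤ P.β / P.α * ∫ x in (0 : ℝ)..s₀, (T₀ x - P.Tm) := by positivity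
    linarith
  -- Since `c₁ σ = q + h₃`, one has `V = A (q + h₃) + h₃ ≤ (A + 1)(q + h₃)`; dividing by `A + 1`
  -- turns the decay in `q` and `h₃` into the rate `b₀`.
  obtain ⟨A, hA⟩ : ∃ A, A = (G.μ₁ + G.c₁) / G.c₁ := ⟨_, rfl⟩
  have hA1 : 1 ≤ A := by rw [hA, le_div_iff₀ hc₁]; linarith
  obtain ⟨b₀, hb₀⟩ : ∃ b₀, b₀ = min G.c₁ ((1 - G.δ₂) * G.c₂) / (A + 1) := ⟨_, rfl⟩
  have hb₀pos : 0 < b₀ := by rw [hb₀]; exact div_pos (lt_min hc₁ hd₂) (by linarith)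
  obtain ⟨C, hC⟩ : ∃ C, C = P.α * sr / P.k ^ 2 := ⟨_, rfl⟩
  have hCpos : 0 < C := by rw [hC]; positivity
  -- `K V²` loses at least `2 K b₀ V²`: one half absorbs the forcing `C q² ≤ C V²`, the other keeps
  -- the rate `b₀`.
  obtain ⟨K, hK⟩ : ∃ K, K = C / b₀ := ⟨_, rfl⟩
  have hKpos : 0 < K := by rw [hK]; positivity
  have hKb : K * b₀ = C := by rw [hK]; field_simp
  obtain ⟨g, hg⟩ : ∃ g, g = (G.μ₁ + 2 * G.c₁) * (P.k / P.β) := ⟨_, rfl⟩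
  have hgpos : 0 < g := by rw [hg]; positivity
  obtain ⟨m, hm⟩ : ∃ m, m = 1 + 2 * (P.β / P.α) ^ 2 * sr := ⟨_, rfl⟩
  have hmpos : 0 < m := by rw [hm]; positivity
  obtain ⟨n, hn⟩ : ∃ n, n = 1 + 2 * (P.β / (P.k * G.c₁)) ^ 2 := ⟨_, rfl⟩
  have hnpos : 0 < n := by rw [hn]; positivity
  refine ⟨(m + n / K) * (1 + K * g ^ 2), by positivity, min (P.α / sr ^ 2) b₀,
    lt_min (by positivity) hb₀pos, ?_⟩
  intro s₀ T₀ T s q U e tEnd hs₀ _ _ hT₀ _ hs0 hTT₀ hq0 _ hgain h t ht htE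
  subst hs0
  have h0E : ((0 : ℝ) : EReal) < tEnd := (EReal.coe_le_coe_iff.2 ht).trans_lt htE
  have hb0 : 0 ≤ barrierThree P G sr T s q 0 := by simp only [barrierThree]; linarith
  -- The initial profile is prescribed only for `x > 0`; the bound at `x = 0` follows by continuity.
  have hTin : ∀ x ∈ Icc 0 (s 0), P.Tm ≤ T x 0 := by
    have hcl : closure (Ioc 0 (s 0)) = Icc 0 (s 0) := closure_Ioc hs₀.ne
    intro x hx
    have hc := h.plant.continuousOn_T le_rfl h0E
    rw [← hcl] at hc hx
    exact le_on_closure (f := fun _ => P.Tm) (g := fun x => T x 0)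
      (fun y hy => hTT₀ y hy ▸ hT₀ y (Ioc_subset_Icc_self hy)) continuousOn_const hc hx
  have hbd := fun t ht htE => h.barrier_bounds hk.ne' hα.ne' hβ.ne' hc₁ hc₂ hδ₁ hδ₂ hδ₂' hq0 hb0
    (t := t) ht htE
  have hsafe := fun t ht htE => h.safety hk hα hβ hc₁ hc₂ hδ₁ hδ₂ hδ₂' hq0 hb0 hTin
    (t := t) ht htE
  set σ := energyDeficit P sr T s with hσ
  set h₃ := barrierThree P G sr T s q with hh₃
  have hh₃σ : ∀ t, h₃ t = -q t + G.c₁ * σ t := fun t => rfl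
  let V : ℝ → ℝ := fun t => (G.μ₁ + G.c₁) * σ t + h₃ t
  let V' : ℝ → ℝ := fun t => (G.μ₁ + G.c₁) * -q t + (-U t + G.c₁ * -q t)
  let Y : ℝ → ℝ := fun t => ∫ x in (0 : ℝ)..s t, (T x t - P.Tm) ^ 2
  have hVA : ∀ t, V t = A * (q t + h₃ t) + h₃ t := by
    intro t
    simp only [V, hA, hh₃σ]
    field_simp
    ring
  have hqV : ∀ t : ℝ, 0 ≤ t → (t : EReal) < tEnd → 0 ≤ q t ∧ q t ≤ V t ∧ G.c₁ * σ t ≤ V t := by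
    intro t ht htE
    obtain ⟨b1, b2, -⟩ := hbd t ht htE
    have : q t + h₃ t ≤ A * (q t + h₃ t) := le_mul_of_one_le_left (by linarith) hA1
    have hV := hVA t
    have := hh₃σ t
    exact ⟨b1, by linarith, by linarith⟩
  have hVd : ∀ t : ℝ, 0 < t → (t : EReal) < tEnd → HasDerivWithinAt V (V' t) (Ici t) t :=
    fun t ht htE =>
      (((h.plant.hasDerivAt_energyDeficit hk.ne' hα.ne' hβ.ne' sr ht htE).hasDerivWithinAt).const_mul
        _).add (h.plant.hasDerivWithinAt_barrierThree hk.ne' hα.ne' hβ.ne' ht htE)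
  have hV'le : ∀ t : ℝ, 0 ≤ t → (t : EReal) < tEnd → V' t ≤ -b₀ * V t := by
    intro t ht htE
    obtain ⟨b1, b2, -, b3⟩ := hbd t ht htE
    have hmin : b₀ * (A + 1) = min G.c₁ ((1 - G.δ₂) * G.c₂) := by rw [hb₀]; field_simp
    have m1 : b₀ * (A + 1) ≤ G.c₁ := hmin ▸ min_le_left _ _
    have m2 : b₀ * (A + 1) ≤ (1 - G.δ₂) * G.c₂ := hmin ▸ min_le_right _ _
    have m3 := mul_le_mul_of_nonneg_right m1 b1
    have m4 := mul_le_mul_of_nonneg_right m2 b2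
    have m5 := mul_nonneg hb₀pos.le b1
    simp only [nominalControl, ← hh₃] at b3
    rw [hVA]
    simp only [V']
    linarith
  choose! Y' hYd hYle using fun (t : ℝ) (ht : 0 < t ∧ (t : EReal) < tEnd) =>
    h.plant.exists_hasDerivAt_integral_sq hk hα ht.1 ht.2 (hsafe t ht.1.le ht.2).2.2
  have hY0 : ∀ t : ℝ, 0 ≤ t → (t : EReal) < tEnd → 0 ≤ Y t := fun t ht htE =>
    intervalIntegral.integral_nonneg (h.plant.s_pos t ht htE).le fun x _ => sq_nonneg _
  have hdecay : Y t + K * V t ^ 2 ≤ (Y 0 + K * V 0 ^ 2) *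
      Real.exp (-(min (P.α / sr ^ 2) b₀) * (t - 0)) := by
    have hVc : ContinuousOn V (Icc 0 t) :=
      ((h.plant.continuousOn_energyDeficit sr htE).const_mul _).add
        (h.plant.continuousOn_barrierThree htE)
    have hYc : ContinuousOn Y (Icc 0 t) :=
      h.plant.continuousOn_integral (φ := fun x => x ^ 2) (by fun_prop) htE
    refine le_exp_of_right_deriv_le (f := fun t => Y t + K * V t ^ 2)
      (f' := fun t => Y' t + K * (2 * V t * V' t)) ht (hYc.add ((hVc.pow 2).const_mul K))
      (fun r hr => ?_) (fun r hr => ?_)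
    · have hrE : (r : EReal) < tEnd := (EReal.coe_lt_coe_iff.2 hr.2).trans htE
      have hv := ((hVd r hr.1 hrE).pow 2).const_mul K
      refine (hYd r ⟨hr.1, hrE⟩).hasDerivWithinAt.add (hv.congr_deriv ?_)
      norm_num
    · have hrE : (r : EReal) < tEnd := (EReal.coe_lt_coe_iff.2 hr.2).trans htE
      obtain ⟨v1, v2, -⟩ := hqV r hr.1.le hrE
      have y1 := hYle r ⟨hr.1, hrE⟩
      have y2 := hY0 r hr.1.le hrE
      have v3 := mul_le_mul_of_nonneg_left (hV'le r hr.1.le hrE)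
        (show 0 ≤ 2 * K * V r by have := v1.trans v2; positivity)
      have v4 : C * q r ^ 2 ≤ K * b₀ * V r ^ 2 := by
        rw [hKb]; exact mul_le_mul_of_nonneg_left (pow_le_pow_left₀ v1 v2 2) hCpos.le
      have d1 := mul_le_mul_of_nonneg_right (min_le_left (P.α / sr ^ 2) b₀) y2
      have d2 := mul_le_mul_of_nonneg_right (min_le_right (P.α / sr ^ 2) b₀)
        (show 0 ≤ K * V r ^ 2 by positivity)
      rw [← hC] at y1
      simp only [Y] at d1 ⊢
      linarith
  have hupper : stabilityNorm P sr T s q t ≤ (m + n / K) * (Y t + K * V t ^ 2) := by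
    obtain ⟨v1, v2, v3⟩ := hqV t ht htE
    obtain ⟨i1, i2, i3⟩ := hsafe t ht htE
    have hs := h.plant.s_pos t ht htE
    have hI : (∫ x in (0 : ℝ)..s t, (T x t - P.Tm)) ^ 2 ≤ sr * Y t := by
      have := sq_intervalIntegral_le hs.le
        ((h.plant.continuousOn_T ht htE).sub (continuousOn_const (c := P.Tm)))
      simp only [sub_zero, Pi.sub_apply] at this
      exact this.trans (mul_le_mul_of_nonneg_right i3 (hY0 t ht htE))
    have hσt : σ t = -(P.k / P.α * (∫ x in (0 : ℝ)..s t, (T x t - P.Tm))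
        + P.k / P.β * (s t - sr)) := rfl
    have hYt := hY0 t ht htE
    have hunf : stabilityNorm P sr T s q t = Y t + (s t - sr) ^ 2 + q t ^ 2 := rfl
    rw [hunf]
    generalize (∫ x in (0 : ℝ)..s t, (T x t - P.Tm)) = I at *
    -- Solving the definition of `σ` for the interface error bounds it by `V` and, through
    -- Cauchy–Schwarz, by `Y`.
    have hdist : s t - sr = -(P.β / (P.k * G.c₁) * (G.c₁ * σ t) + P.β / P.α * I) := by
      rw [hσt]; field_simp; ring
    have hsq : (G.c₁ * σ t) ^ 2 ≤ V t ^ 2 := pow_le_pow_left₀ (by positivity) v3 2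
    have hq2 : q t ^ 2 ≤ V t ^ 2 := pow_le_pow_left₀ v1 v2 2
    have k1 : (s t - sr) ^ 2 ≤ 2 * (P.β / (P.k * G.c₁)) ^ 2 * V t ^ 2
        + 2 * (P.β / P.α) ^ 2 * (sr * Y t) := by
      have j1 := mul_le_mul_of_nonneg_left hsq (show 0 ≤ 2 * (P.β / (P.k * G.c₁)) ^ 2 by positivity)
      have j2 := mul_le_mul_of_nonneg_left hI (show 0 ≤ 2 * (P.β / P.α) ^ 2 by positivity)
      rw [hdist]
      exact (sq_neg_add_le _ _ _ _).trans (add_le_add j1 j2)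
    have k2 : Y t + (s t - sr) ^ 2 + q t ^ 2 ≤ m * Y t + n * V t ^ 2 := by
      rw [hm, hn]; linarith
    have k3 : (m + n / K) * (Y t + K * V t ^ 2) =
        m * Y t + n * V t ^ 2 + (m * K * V t ^ 2 + n / K * Y t) := by
      field_simp
      ring
    have k4 : 0 ≤ m * K * V t ^ 2 + n / K * Y t := by positivity
    linarith
  have hlower : Y 0 + K * V 0 ^ 2 ≤ (1 + K * g ^ 2) * stabilityNorm P sr T s q 0 := by
    obtain ⟨v1, v2, -⟩ := hqV 0 le_rfl h0E
    obtain ⟨i1, i2, i3⟩ := hsafe 0 le_rfl h0E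
    have hY := hY0 0 le_rfl h0E
    have hσ0 : σ 0 = -(P.k / P.α * (∫ x in (0 : ℝ)..s 0, (T x 0 - P.Tm))
        + P.k / P.β * (s 0 - sr)) := rfl
    have hσle : σ 0 ≤ P.k / P.β * (sr - s 0) := by
      have : 0 ≤ P.k / P.α * (∫ x in (0 : ℝ)..s 0, (T x 0 - P.Tm)) := by positivity
      rw [hσ0]; linarith
    -- As `q ≥ 0` gives `h₃ ≤ c₁ σ`, one has `V ≤ (μ₁ + 2 c₁) σ`, which explains the constant `g`.
    have hVle : V 0 ≤ g * (sr - s 0) := by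
      have j := mul_le_mul_of_nonneg_left hσle (show 0 ≤ G.μ₁ + 2 * G.c₁ by positivity)
      simp only [V, hh₃σ]
      rw [hg]
      linarith
    have hVsq : V 0 ^ 2 ≤ g ^ 2 * (s 0 - sr) ^ 2 :=
      (pow_le_pow_left₀ (v1.trans v2) hVle 2).trans (by rw [mul_pow]; apply le_of_eq; ring)
    have hKV := mul_le_mul_of_nonneg_left hVsq hKpos.le
    have hunf : stabilityNorm P sr T s q 0 = Y 0 + (s 0 - sr) ^ 2 + q 0 ^ 2 := rfl
    rw [hunf]
    have z1 : 0 ≤ K * g ^ 2 * (Y 0 + q 0 ^ 2) := by positivity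
    have z2 := sq_nonneg (s 0 - sr)
    have z3 := sq_nonneg (q 0)
    nlinarith
  rw [sub_zero] at hdecay
  have hexp := Real.exp_pos (-(min (P.α / sr ^ 2) b₀) * t)
  calc stabilityNorm P sr T s q t ≤ (m + n / K) * (Y t + K * V t ^ 2) := hupper
    _ ≤ (m + n / K) * ((Y 0 + K * V 0 ^ 2) * Real.exp (-(min (P.α / sr ^ 2) b₀) * t)) := by
      gcongr
    _ ≤ (m + n / K) * ((1 + K * g ^ 2) * stabilityNorm P sr T s q 0 *
        Real.exp (-(min (P.α / sr ^ 2) b₀) * t)) := by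
      gcongr
    _ = _ := by ring

end
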